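/- Consider the negative unity feedback loop with plant $P(s)$ and controller $G(s)$, rational transfer functions with real coefficients, and let $L=PG$ be the loop function. Assume that no pole of $P$ or $G$ in the closed right half plane is cancelled by a zero of the other factor, and that $L$ has $n\ge 0$ unstable poles (poles with positive real part, counted with multiplicity). The feedback system is called stable if all its poles, i.e. all zeros of the characteristic function $Q=1+L$ (including any that are hidden by a cancellation in $PG$), have negative real part. For $R,\varepsilon>0$ let $\Gamma=\Gamma_{R,\varepsilon}$ be the standard Nyquist contour: it is traversed clockwise, goes up the imaginary axis from $-iR$ to $iR$, passing every pole of $L$ on the axis on its right along a semicircle of radius $\varepsilon$, and returns along the semicircle $|s|=R$, $\operatorname{Re}s\ge 0$. Call $\Gamma$ admissible if $|p|+\varepsilon<R$ for every pole $p$ of $L$ with $\operatorname{Re}p\ge 0$, and every pole of $L$ on the imaginary axis has distance greater than $2\varepsilon$ from every other pole of $L$ in the closed right half plane. The Nyquist plot is the closed curve $L(\Gamma)$. The single-sheeted Nichols plot is its image under $z\mapsto(\phi,r)$, where $\phi\in[-360^\circ,0)$ is the argument of $z$ in degrees modulo $360^\circ$ and $r=20\log_{10}|z|$ dB ($r=-\infty$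 for $z=0$). The crossings of the ray $\{\phi=-180^\circ,\ r>0\,\mathrm{dB}\}$ by the Nichols plot are counted $+1$ if the plot passes the ray from right to left (decreasing phase), $-1$ if it passes from left to right, and $0$ if it touches the ray and returns to the side it came from. A stretch along which the plot runs inside the ray is counted in the same way, by the sides on which the plot lies just before and just after it (formally, half of the sign is counted at each end of the stretch). Encirclements of $-1$ by the Nyquist plot are counted positive if clockwise. Then: 1. For every admissible $\Gamma$ there are only finitely many crossings with a nonzero sign, and if the Nyquist plot does not pass through $-1$, then the sum of the crossings of the single-sheeted Nichols plot equals the number of encirclements of $-1$ by the Nyquist plot. 2. There are $R_0>0$ and $\varepsilon_0>0$ such that for all $R>R_0$ and $0<\varepsilon<\varepsilon_0$ the contour $\Gamma_{R,\varepsilon}$ is admissible, and the feedback system is stable if and only if the single-sheeted Nichols plot does not pass through the critical point $(-180^\circ,0\,\mathrm{dB})$ and the sum of its crossings with the ray equals $-n$. In particular, the two assertions are equivalent, since both hold. -/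

import Mathlib

open Filter Topology

noncomputable section

namespace Nichols

/-! ### The feedback loop

The plant `P` and the controller `G` are rational transfer functions with real coefficients, the
loop function is `L = P * G`, and the characteristic function is `Q = 1 + L`. -/

/-- The value `L(s)` at a complex point `s` of a rational function with real coefficients. -/
def tfEval (L : RatFunc ℝ) (s : ℂ) : ℂ := L.eval (algebraMap ℝ ℂ) s

/-- `s` is a pole of `L` (a `RatFunc` is reduced: `L.num` and `L.denom` are coprime). -/
def IsPole (L : RatFunc ℝ) (s : ℂ) : Prop := Polynomial.aeval s L.denom = 0

/-- The number of unstable poles of `L`, that is, of poles with positive real part, counted with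
multiplicity. -/
def unstablePoleCount (L : RatFunc ℝ) : ℕ :=
  (L.denom.aroots ℂ).countP (fun p => 0 < p.re)

open Classical in
/-- The poles of `L` on the imaginary axis. -/
def imagAxisPoles (L : RatFunc ℝ) : Finset ℂ :=
  (L.denom.aroots ℂ).toFinset.filter (fun p => p.re = 0)

/-- No pole of one of the factors `P`, `G` in the closed right half plane is cancelled by a zero of
the other one when the product `P * G` is formed. -/
def NoUnstableCancellation (P G : RatFunc ℝ) : Prop :=
  ∀ s : ℂ, 0 ≤ s.re →
    ¬ (Polynomial.aeval s (P.num * G.num) = 0 ∧ Polynomial.aeval s (P.denom * G.denom) = 0)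

/-- The closed-loop poles: the zeros of the characteristic function
`Q = 1 + P * G = (P.num * G.num + P.denom * G.denom) / (P.denom * G.denom)`, the numerator being
taken before any cancellation, so that modes hidden by a cancellation are included. -/
def IsClosedLoopPole (P G : RatFunc ℝ) (s : ℂ) : Prop :=
  Polynomial.aeval s (P.num * G.num + P.denom * G.denom) = 0

/-- The feedback system is stable: every closed-loop pole has negative real part. -/
def ClosedLoopStable (P G : RatFunc ℝ) : Prop :=
  ∀ s : ℂ, IsClosedLoopPole P G s → s.re < 0

/-! ### The Nyquist contour and the Nyquist plot -/

/-- The real part of the point at height `y` on the left side of the contour: `0`, except that a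
pole on the imaginary axis is passed on the right along a semicircle of radius `ε` centred at it
(`Real.sqrt` is `0` at negative arguments). -/
def indentation (L : RatFunc ℝ) (ε y : ℝ) : ℝ :=
  ∑ p ∈ imagAxisPoles L, √(ε ^ 2 - (y - p.im) ^ 2)

/-- The standard Nyquist contour, clockwise, as a function of period `1`: for `0 ≤ t ≤ 1/2` it goes
up the indented imaginary axis from `-iR` to `iR`, and for `1/2 ≤ t ≤ 1` it returns from `iR` to
`-iR` along the semicircle of radius `R` in the right half plane. -/
def contour (L : RatFunc ℝ) (R ε : ℝ) (t : ℝ) : ℂ :=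
  if Int.fract t ≤ 1 / 2 then
    ⟨indentation L ε (R * (4 * Int.fract t - 1)), R * (4 * Int.fract t - 1)⟩
  else
    R * Complex.exp (((Real.pi * (3 / 2 - 2 * Int.fract t) : ℝ) : ℂ) * Complex.I)

/-- `R` is so large and `ε` so small that the contour is a closed curve which encloses all poles of
`L` with positive real part, and detours every pole on the imaginary axis by its own semicircle. -/
structure IsAdmissible (L : RatFunc ℝ) (R ε : ℝ) : Prop where
  radius_pos : 0 < R
  eps_pos : 0 < ε
  encloses : ∀ p : ℂ, IsPole L p → 0 ≤ p.re → ‖p‖ + ε < R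
  separated : ∀ p q : ℂ, IsPole L p → IsPole L q → p.re = 0 → 0 ≤ q.re → p ≠ q → 2 * ε < ‖p - q‖

/-- The Nyquist plot: the image of the contour under `L`. -/
def nyquistPlot (L : RatFunc ℝ) (R ε : ℝ) (t : ℝ) : ℂ := tfEval L (contour L R ε t)

/-- The closed curve `γ` (on `[0, 1]`) avoids `w` and encircles it `N` times, clockwise encirclements
counted positive: along a continuous argument `θ` of `γ - w`, the total change is `-2πN`. -/
def Encircles (γ : ℝ → ℂ) (w : ℂ) (N : ℤ) : Prop :=
  (∀ t ∈ Set.Icc (0 : ℝ) 1, γ t ≠ w) ∧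
    ∃ θ : ℝ → ℝ, ContinuousOn θ (Set.Icc 0 1) ∧
      (∀ t ∈ Set.Icc (0 : ℝ) 1,
        γ t - w = (‖γ t - w‖ : ℂ) * Complex.exp ((θ t : ℂ) * Complex.I)) ∧
      θ 0 - θ 1 = 2 * Real.pi * N

/-! ### The single-sheeted Nichols chart -/

/-- The phase in degrees, shifted by a multiple of `360` into `[-360, 0)`. -/
def phaseDeg (z : ℂ) : ℝ :=
  toIcoMod (show (0 : ℝ) < 360 by norm_num) (-360) (Complex.arg z * 180 / Real.pi)

/-- The magnitude in decibels; it is `-∞` at the origin. -/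
def magDB (z : ℂ) : EReal :=
  open Classical in if z = 0 then ⊥ else ((20 * Real.logb 10 ‖z‖ : ℝ) : EReal)

/-- The map from the complex plane to the single-sheeted Nichols chart. -/
def nicholsMap (z : ℂ) : ℝ × EReal := (phaseDeg z, magDB z)

/-- The single-sheeted Nichols plot of `L`. -/
def nicholsPlot (L : RatFunc ℝ) (R ε : ℝ) (t : ℝ) : ℝ × EReal := nicholsMap (nyquistPlot L R ε t)

/-- The critical point `(-180°, 0 dB)`. -/
def criticalPoint : ℝ × EReal := (-180, 0)

/-- The ray at phase `-180°` and magnitude `> 0 dB`. -/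
def criticalRay : Set (ℝ × EReal) := {a | a.1 = -180 ∧ 0 < a.2}

open Classical in
/-- The side of the line of phase `-180°` on which the curve `c` lies along the filter `l`:
`1` for the left, `-1` for the right, `0` otherwise (the curve runs along the line). -/
def side (c : ℝ → ℝ × EReal) (l : Filter ℝ) : ℚ :=
  if ∀ᶠ u in l, (c u).1 < -180 then 1
  else if ∀ᶠ u in l, -180 < (c u).1 then -1
  else 0

open Classical in
/-- The sign of the crossing of the ray by the curve `c` at the parameter `t`: `1` if `c` passes from
the right of the ray to its left, `-1` if it passes from the left to the right, and `0` if it touches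
the ray and goes back to the side it came from, or does not meet it. If `c` runs along the ray for a
while, this counts one half, with the sign of the direction, where `c` enters the ray and one half
where it leaves it, so that the whole passage counts `1`, `-1` or `0` by the same rule. -/
def crossingSign (c : ℝ → ℝ × EReal) (t : ℝ) : ℚ :=
  if c t ∈ criticalRay then (side c (𝓝[>] t) - side c (𝓝[<] t)) / 2 else 0

/-- The parameters in one period at which there is a signed crossing. -/
def crossingSet (c : ℝ → ℝ × EReal) : Set ℝ := {t | t ∈ Set.Ico 0 1 ∧ crossingSign c t ≠ 0}

/-- The sum of the crossings over one period. -/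
def crossingSum (c : ℝ → ℝ × EReal) : ℚ := ∑ᶠ t ∈ Set.Ico (0 : ℝ) 1, crossingSign c t

end Nichols

end

/-!
The Nyquist criterion is proved by following arguments along the contour, without contour integrals.

*Winding numbers.* Continuous arguments add under multiplication, and `1 + L` is a constant times a
product of factors `s - r` and their inverses, over its zeros and poles `r`. The contour winds once,
clockwise, around each `r` with positive real part (`IsAdmissible.encircles_one`: two branches of the
argument are glued at `iR`) and does not wind around the others, because it stays in the closed right
half plane (`IsAdmissible.encircles_zero`). Hence the Nyquist plot encircles `-1` exactly `Z - n`
times, where `Z` counts the zeros of `1 + L` in the open right half plane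
(`IsAdmissible.encircles_neg_one`).

*Crossings.* Let `θ` be a continuous argument of `L + 1` along the contour. The plot is on the critical
ray exactly when `θ` is an odd multiple of `π`, that is, on the boundary between two sheets of
length `2π`. Number the sheets by half-integers and the boundaries by integers. Then the contribution
of either side of `t` to the signed crossing at `t` is the jump of the sheet number on that side
(`IsSideOf.eventually_sheet_eq`), and the jumps over a period telescope (`finsum_jumps`) to the
change of `θ` divided by `-2π`, which is the number of encirclements (`IsAdmissible.crossingSum_eq`).
This needs that `Im L` has a constant sign on each side of every `t` (`IsAdmissible.signedAlong_im`).
It holds since the contour is piecewise analytic, and it also makes the signed crossings isolated, so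
that there are finitely many of them (`IsAdmissible.finite_crossingSet`).

*The criterion.* Without unstable cancellations the closed-loop poles in the closed right half plane
are the zeros of `1 + L` there (`isClosedLoopPole_iff`). For large `R` and small `ε` the zeros on the
imaginary axis lie on the contour, and those in the open half plane are enclosed by it. So if the plot
avoids the critical point, the crossings add up to `Z - n`, and this is `-n` exactly when `Z = 0`.
-/

namespace Nichols

variable {L : RatFunc ℝ} {R ε : ℝ}

/-! ### Geometry of the Nyquist contour -/

lemma mem_imagAxisPoles {p : ℂ} : p ∈ imagAxisPoles L ↔ IsPole L p ∧ p.re = 0 := by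
  simp [imagAxisPoles, IsPole, L.denom_ne_zero]

lemma indentation_nonneg (L : RatFunc ℝ) (ε y : ℝ) : 0 ≤ indentation L ε y :=
  Finset.sum_nonneg fun _ _ => Real.sqrt_nonneg _

lemma norm_sub_sq_of_re_eq_zero {z p : ℂ} (hp : p.re = 0) :
    ‖z - p‖ ^ 2 = z.re ^ 2 + (z.im - p.im) ^ 2 := by
  rw [Complex.sq_norm, Complex.normSq_apply]
  simp [hp]
  ring

lemma sqrt_sub_sq_eq_zero {y q : ℝ} (hε : 0 ≤ ε) (h : ε ≤ |y - q|) :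
    √(ε ^ 2 - (y - q) ^ 2) = 0 := by
  apply Real.sqrt_eq_zero_of_nonpos
  have := pow_le_pow_left₀ hε h 2
  rw [sq_abs] at this
  linarith

lemma indentation_eq_zero {y : ℝ} (hε : 0 ≤ ε) (h : ∀ p ∈ imagAxisPoles L, ε ≤ |y - p.im|) :
    indentation L ε y = 0 :=
  Finset.sum_eq_zero fun p hp => sqrt_sub_sq_eq_zero hε (h p hp)

/-- The semicircles around distinct poles on the imaginary axis do not overlap. -/
lemma IsAdmissible.indentation_eq_sqrt (h : IsAdmissible L R ε) {y : ℝ} {p : ℂ}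
    (hp : p ∈ imagAxisPoles L) (hy : |y - p.im| ≤ ε) :
    indentation L ε y = √(ε ^ 2 - (y - p.im) ^ 2) := by
  refine Finset.sum_eq_single_of_mem p hp fun q hq hqp => sqrt_sub_sq_eq_zero h.eps_pos.le ?_
  rw [mem_imagAxisPoles] at hp hq
  have h1 := h.separated p q hp.1 hq.1 hp.2 hq.2.ge hqp.symm
  have h2 : ‖p - q‖ = |p.im - q.im| := by
    rw [← sq_eq_sq₀ (norm_nonneg _) (abs_nonneg _), norm_sub_sq_of_re_eq_zero hq.2, hp.2, sq_abs]
    ring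
  rw [h2] at h1
  have := abs_sub_le p.im y q.im
  rw [abs_sub_comm p.im y] at this
  linarith

lemma IsAdmissible.abs_im_add_lt (h : IsAdmissible L R ε) {p : ℂ} (hp : p ∈ imagAxisPoles L) :
    |p.im| + ε < R := by
  rw [mem_imagAxisPoles] at hp
  linarith [h.encloses p hp.1 hp.2.ge, Complex.abs_im_le_norm p]

lemma IsAdmissible.indentation_eq_zero_of_abs_eq (h : IsAdmissible L R ε) {y : ℝ} (hy : |y| = R) :
    indentation L ε y = 0 := by
  refine indentation_eq_zero h.eps_pos.le fun p hp => ?_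
  linarith [h.abs_im_add_lt hp, abs_sub_abs_le_abs_sub y p.im]

/-- One period of the contour, as a function on `[0, 1]`. -/
noncomputable def contourBase (L : RatFunc ℝ) (R ε t : ℝ) : ℂ :=
  if t ≤ 1 / 2 then ⟨indentation L ε (R * (4 * t - 1)), R * (4 * t - 1)⟩
  else R * Complex.exp (((Real.pi * (3 / 2 - 2 * t) : ℝ) : ℂ) * Complex.I)

lemma contour_eq_comp_fract (L : RatFunc ℝ) (R ε : ℝ) :
    contour L R ε = contourBase L R ε ∘ Int.fract := rfl

lemma contourBase_of_le {t : ℝ} (ht : t ≤ 1 / 2) : contourBase L R ε t =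
    ⟨indentation L ε (R * (4 * t - 1)), R * (4 * t - 1)⟩ := if_pos ht

lemma IsAdmissible.contourBase_of_ge (h : IsAdmissible L R ε) {t : ℝ} (ht : 1 / 2 ≤ t) :
    contourBase L R ε t =
      R * Complex.exp (((Real.pi * (3 / 2 - 2 * t) : ℝ) : ℂ) * Complex.I) := by
  rcases ht.eq_or_lt with rfl | ht
  · have e : R * (4 * (1 / 2) - 1) = R := by ring
    rw [contourBase_of_le le_rfl, e, h.indentation_eq_zero_of_abs_eq (abs_of_pos h.radius_pos),
      show Real.pi * (3 / 2 - 2 * (1 / 2)) = Real.pi / 2 by ring]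
    apply Complex.ext <;> simp
  · exact if_neg ht.not_ge

lemma IsAdmissible.contourBase_zero (h : IsAdmissible L R ε) :
    contourBase L R ε 0 = -(R * Complex.I) := by
  have e : R * (4 * 0 - 1) = -R := by ring
  rw [contourBase_of_le (by norm_num), e,
    h.indentation_eq_zero_of_abs_eq (by rw [abs_neg, abs_of_pos h.radius_pos])]
  apply Complex.ext <;> simp

lemma IsAdmissible.contourBase_one (h : IsAdmissible L R ε) :
    contourBase L R ε 1 = -(R * Complex.I) := by
  rw [h.contourBase_of_ge (by norm_num),
    show Real.pi * (3 / 2 - 2 * 1) = -(Real.pi / 2) by ring]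
  push_cast
  rw [neg_mul, Complex.exp_neg, Complex.exp_pi_div_two_mul_I]
  simp

lemma IsAdmissible.contour_eq (h : IsAdmissible L R ε) {t : ℝ} (ht : t ∈ Set.Icc (0 : ℝ) 1) :
    contour L R ε t = contourBase L R ε t := by
  rw [contour_eq_comp_fract, Function.comp_apply]
  rcases ht.2.eq_or_lt with rfl | h1
  · rw [Int.fract_one, h.contourBase_zero, h.contourBase_one]
  · rw [Int.fract_eq_self.2 ⟨ht.1, h1⟩]

lemma continuous_indentation (L : RatFunc ℝ) (ε : ℝ) : Continuous (indentation L ε) := by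
  unfold indentation
  fun_prop

lemma continuousOn_contourBase_left :
    ContinuousOn (contourBase L R ε) (Set.Icc 0 (1 / 2)) := by
  have : Continuous fun t : ℝ =>
      ((indentation L ε (R * (4 * t - 1)) : ℝ) : ℂ) + ((R * (4 * t - 1) : ℝ) : ℂ) * Complex.I := by
    have := continuous_indentation L ε
    fun_prop
  refine this.continuousOn.congr fun t ht => ?_
  rw [contourBase_of_le ht.2]
  apply Complex.ext <;> simp

lemma IsAdmissible.continuousOn_contourBase_right (h : IsAdmissible L R ε) :
    ContinuousOn (contourBase L R ε) (Set.Icc (1 / 2) 1) := by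
  have : Continuous fun t : ℝ =>
      R * Complex.exp (((Real.pi * (3 / 2 - 2 * t) : ℝ) : ℂ) * Complex.I) := by
    fun_prop
  exact this.continuousOn.congr fun t ht => h.contourBase_of_ge ht.1

lemma Icc_union_half : Set.Icc (0 : ℝ) (1 / 2) ∪ Set.Icc (1 / 2) 1 = Set.Icc 0 1 :=
  Set.Icc_union_Icc_eq_Icc (by norm_num) (by norm_num)

lemma continuousOn_unit_of_halves {f : ℝ → ℝ} (h₁ : ContinuousOn f (Set.Icc 0 (1 / 2)))
    (h₂ : ContinuousOn f (Set.Icc (1 / 2) 1)) : ContinuousOn f (Set.Icc 0 1) := by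
  rw [← Icc_union_half]
  exact h₁.union_of_isClosed h₂ isClosed_Icc isClosed_Icc

lemma IsAdmissible.continuous_contour (h : IsAdmissible L R ε) : Continuous (contour L R ε) := by
  rw [contour_eq_comp_fract]
  refine ContinuousOn.comp_fract'' ?_ (by rw [h.contourBase_zero, h.contourBase_one])
  rw [← Icc_union_half]
  exact continuousOn_contourBase_left.union_of_isClosed h.continuousOn_contourBase_right
    isClosed_Icc isClosed_Icc

/-- A point of the contour lies on the imaginary axis at distance at least `ε` from its poles, on
one of the small semicircles, or on the large semicircle. -/
lemma IsAdmissible.contour_cases (h : IsAdmissible L R ε) (t : ℝ) :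
    ((contour L R ε t).re = 0 ∧ ∀ p ∈ imagAxisPoles L, ε ≤ ‖contour L R ε t - p‖) ∨
      (∃ p ∈ imagAxisPoles L, ‖contour L R ε t - p‖ = ε) ∨ ‖contour L R ε t‖ = R := by
  rw [contour_eq_comp_fract, Function.comp_apply]
  rcases le_total (Int.fract t) (1 / 2) with ht | ht
  · rw [contourBase_of_le ht]
    set y := R * (4 * Int.fract t - 1)
    by_cases hy : ∀ p ∈ imagAxisPoles L, ε ≤ |y - p.im|
    · refine Or.inl ⟨indentation_eq_zero h.eps_pos.le hy, fun p hp => (hy p hp).trans ?_⟩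
      exact Complex.abs_im_le_norm (⟨indentation L ε y, y⟩ - p)
    · push Not at hy
      obtain ⟨p, hp, hy⟩ := hy
      refine Or.inr (Or.inl ⟨p, hp, ?_⟩)
      rw [← sq_eq_sq₀ (norm_nonneg _) h.eps_pos.le,
        norm_sub_sq_of_re_eq_zero (mem_imagAxisPoles.1 hp).2]
      simp only
      rw [h.indentation_eq_sqrt hp hy.le, Real.sq_sqrt, sub_add_cancel]
      have := pow_le_pow_left₀ (abs_nonneg _) hy.le 2
      rw [sq_abs] at this
      linarith
  · right; right
    rw [h.contourBase_of_ge ht, norm_mul, Complex.norm_exp_ofReal_mul_I, mul_one,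
      Complex.norm_of_nonneg h.radius_pos.le]

lemma IsAdmissible.re_contour_nonneg (h : IsAdmissible L R ε) (t : ℝ) :
    0 ≤ (contour L R ε t).re := by
  rw [contour_eq_comp_fract, Function.comp_apply]
  rcases le_total (Int.fract t) (1 / 2) with ht | ht
  · rw [contourBase_of_le ht]
    exact indentation_nonneg _ _ _
  · rw [h.contourBase_of_ge ht, Complex.re_ofReal_mul, Complex.exp_ofReal_mul_I_re]
    refine mul_nonneg h.radius_pos.le (Real.cos_nonneg_of_mem_Icc ⟨?_, ?_⟩) <;>
      nlinarith [Real.pi_pos, (Int.fract_lt_one t).le]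

lemma IsAdmissible.not_isPole_contour (h : IsAdmissible L R ε) (t : ℝ) :
    ¬ IsPole L (contour L R ε t) := by
  intro hs
  have hε := h.eps_pos
  have hre := h.re_contour_nonneg t
  rcases h.contour_cases t with ⟨h0, h1⟩ | ⟨p, hp, h1⟩ | h1
  · have := h1 _ (mem_imagAxisPoles.2 ⟨hs, h0⟩)
    rw [sub_self, norm_zero] at this
    linarith
  · rw [mem_imagAxisPoles] at hp
    have hne : p ≠ contour L R ε t := by
      rintro e
      rw [← e, sub_self, norm_zero] at h1
      linarith
    have := h.separated p _ hp.1 hs hp.2 hre hne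
    rw [norm_sub_rev] at this
    linarith
  · have := h.encloses _ hs hre
    linarith

lemma contour_add_one (L : RatFunc ℝ) (R ε t : ℝ) : contour L R ε (t + 1) = contour L R ε t := by
  simp [contour_eq_comp_fract]

/-! ### Winding numbers of products and around single points -/

lemma encircles_sub_iff {γ : ℝ → ℂ} {w : ℂ} {N : ℤ} :
    Encircles (fun t => γ t - w) 0 N ↔ Encircles γ w N := by
  simp [Encircles, sub_eq_zero]

lemma Encircles.congr {γ₁ γ₂ : ℝ → ℂ} {w : ℂ} {N : ℤ} (h : Encircles γ₁ w N)
    (he : ∀ t ∈ Set.Icc (0 : ℝ) 1, γ₂ t = γ₁ t) : Encircles γ₂ w N := by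
  obtain ⟨h0, θ, hc, hθ, h1⟩ := h
  exact ⟨fun t ht => he t ht ▸ h0 t ht, θ, hc, fun t ht => he t ht ▸ hθ t ht, h1⟩

lemma encircles_const {k : ℂ} (hk : k ≠ 0) : Encircles (fun _ => k) 0 0 :=
  ⟨fun _ _ => hk, fun _ => k.arg, continuousOn_const,
    fun _ _ => by rw [sub_zero, Complex.norm_mul_exp_arg_mul_I], by simp⟩

lemma Encircles.mul {γ₁ γ₂ : ℝ → ℂ} {N₁ N₂ : ℤ} (h₁ : Encircles γ₁ 0 N₁) (h₂ : Encircles γ₂ 0 N₂) :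
    Encircles (fun t => γ₁ t * γ₂ t) 0 (N₁ + N₂) := by
  obtain ⟨a₁, θ₁, c₁, e₁, d₁⟩ := h₁
  obtain ⟨a₂, θ₂, c₂, e₂, d₂⟩ := h₂
  refine ⟨fun t ht => mul_ne_zero (a₁ t ht) (a₂ t ht), fun t => θ₁ t + θ₂ t, c₁.add c₂,
    fun t ht => ?_, ?_⟩
  · have h1 := e₁ t ht
    have h2 := e₂ t ht
    rw [sub_zero] at h1 h2 ⊢
    rw [norm_mul]
    push_cast
    rw [add_mul, Complex.exp_add]
    conv_lhs => rw [h1, h2]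
    ring
  · push_cast
    linarith

lemma Encircles.inv {γ : ℝ → ℂ} {N : ℤ} (h : Encircles γ 0 N) :
    Encircles (fun t => (γ t)⁻¹) 0 (-N) := by
  obtain ⟨a, θ, c, e, d⟩ := h
  refine ⟨fun t ht => inv_ne_zero (a t ht), fun t => -θ t, c.neg, fun t ht => ?_, ?_⟩
  · have h1 := e t ht
    rw [sub_zero] at h1 ⊢
    rw [norm_inv]
    push_cast
    rw [neg_mul, Complex.exp_neg, ← mul_inv, ← h1]
  · push_cast
    linarith

open Classical in
lemma Encircles.multiset_prod {γ : ℝ → ℂ} {q : ℂ → Prop} (s : Multiset ℂ)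
    (h : ∀ r ∈ s, Encircles γ r (if q r then 1 else 0)) :
    Encircles (fun t => (s.map fun r => γ t - r).prod) 0 (s.countP q) := by
  induction s using Multiset.induction_on with
  | empty => simpa using encircles_const one_ne_zero
  | cons r s ih =>
    have h1 := encircles_sub_iff.2 (h r (Multiset.mem_cons_self r s))
    have h2 := h1.mul (ih fun x hx => h x (Multiset.mem_cons_of_mem hx))
    simp only [Multiset.map_cons, Multiset.prod_cons, Multiset.countP_cons]
    convert h2 using 1
    push_cast
    rw [add_comm]

/-- A closed curve in the closed right half plane does not encircle a point outside the open right
half plane: the principal argument is a continuous argument. -/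
lemma encircles_zero_of_re_nonpos {γ : ℝ → ℂ} (hc : ContinuousOn γ (Set.Icc 0 1))
    (h01 : γ 0 = γ 1) (hre : ∀ t, 0 ≤ (γ t).re) {z : ℂ} (hz : z.re ≤ 0)
    (hne : ∀ t ∈ Set.Icc (0 : ℝ) 1, γ t ≠ z) : Encircles γ z 0 := by
  refine ⟨hne, fun t => (γ t - z).arg, fun t ht => ?_, fun t _ => ?_, by simp [h01]⟩
  · refine (Complex.continuousAt_arg ?_).comp_continuousWithinAt ((hc t ht).sub_const z)
    rw [Complex.mem_slitPlane_iff]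
    by_contra! hcon
    refine hne t ht (Complex.ext ?_ ?_)
    · have := hcon.1
      rw [Complex.sub_re] at this
      linarith [hre t]
    · exact sub_eq_zero.1 hcon.2
  · rw [Complex.norm_mul_exp_arg_mul_I]

lemma IsAdmissible.encircles_zero (h : IsAdmissible L R ε) {z : ℂ} (hz : z.re ≤ 0)
    (hne : ∀ t, contour L R ε t ≠ z) : Encircles (contour L R ε) z 0 :=
  encircles_zero_of_re_nonpos h.continuous_contour.continuousOn
    (by rw [← contour_add_one, zero_add]) h.re_contour_nonneg hz fun t _ => hne t

lemma IsAdmissible.indentation_lt_re (h : IsAdmissible L R ε) {z : ℂ} (hz : 0 < z.re)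
    (hfar : ∀ p ∈ imagAxisPoles L, ε < ‖z - p‖) : indentation L ε z.im < z.re := by
  by_cases hy : ∀ p ∈ imagAxisPoles L, ε ≤ |z.im - p.im|
  · rwa [indentation_eq_zero h.eps_pos.le hy]
  · push Not at hy
    obtain ⟨p, hp, hy⟩ := hy
    rw [h.indentation_eq_sqrt hp hy.le, Real.sqrt_lt' hz]
    have h1 := pow_lt_pow_left₀ (hfar p hp) h.eps_pos.le two_ne_zero
    rw [norm_sub_sq_of_re_eq_zero (mem_imagAxisPoles.1 hp).2] at h1
    linarith

/-- The contour winds once, clockwise, around the points it encloses: to the left half of the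
contour the ray from `z` to the right stays free, to the large semicircle the ray to the left. -/
lemma IsAdmissible.encircles_one (h : IsAdmissible L R ε) {z : ℂ} (hz : 0 < z.re) (hzR : ‖z‖ < R)
    (hfar : ∀ p ∈ imagAxisPoles L, ε < ‖z - p‖) : Encircles (contour L R ε) z 1 := by
  have hR := h.radius_pos
  have hcont := h.continuous_contour
  have hleft : ∀ t ∈ Set.Icc (0 : ℝ) (1 / 2), z - contour L R ε t ∈ Complex.slitPlane := by
    intro t ht
    rw [h.contour_eq ⟨ht.1, ht.2.trans (by norm_num)⟩, contourBase_of_le ht.2,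
      Complex.mem_slitPlane_iff]
    by_contra! hcon
    simp only [Complex.sub_re, Complex.sub_im] at hcon
    have h1 := h.indentation_lt_re hz hfar
    rw [sub_eq_zero.1 hcon.2] at h1
    linarith
  have hright : ∀ t ∈ Set.Icc (1 / 2 : ℝ) 1, contour L R ε t - z ∈ Complex.slitPlane := by
    intro t ht
    have hn : ‖contour L R ε t‖ = R := by
      rw [h.contour_eq ⟨le_trans (by norm_num) ht.1, ht.2⟩, h.contourBase_of_ge ht.1, norm_mul,
        Complex.norm_exp_ofReal_mul_I, mul_one, Complex.norm_of_nonneg hR.le]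
    have hre := h.re_contour_nonneg t
    rw [Complex.mem_slitPlane_iff]
    by_contra! hcon
    simp only [Complex.sub_re, Complex.sub_im] at hcon
    have h1 : ‖z‖ ^ 2 < ‖contour L R ε t‖ ^ 2 := by
      rw [hn]
      exact pow_lt_pow_left₀ hzR (norm_nonneg _) two_ne_zero
    rw [Complex.sq_norm, Complex.sq_norm, Complex.normSq_apply, Complex.normSq_apply,
      sub_eq_zero.1 hcon.2] at h1
    nlinarith [hcon.1]
  have him : |z.im| < R := (Complex.abs_im_le_norm z).trans_lt hzR
  rw [abs_lt] at him
  have hc0 : contour L R ε 0 = -(R * Complex.I) := by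
    rw [h.contour_eq (by simp), h.contourBase_zero]
  have hc1 : contour L R ε 1 = -(R * Complex.I) := by
    rw [h.contour_eq (by simp), h.contourBase_one]
  have hc2 : (contour L R ε (1 / 2)).im = R := by
    rw [h.contour_eq (by norm_num), contourBase_of_le le_rfl]
    simp only
    ring
  have hjoin : (z - contour L R ε (1 / 2)).arg + Real.pi = (contour L R ε (1 / 2) - z).arg := by
    rw [← neg_sub, Complex.arg_neg_eq_arg_sub_pi_of_im_pos, sub_add_cancel]
    rw [Complex.sub_im, hc2]
    linarith
  refine ⟨fun t ht heq => ?_, fun t => if t ≤ 1 / 2 then (z - contour L R ε t).arg + Real.pi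
    else (contour L R ε t - z).arg, continuousOn_unit_of_halves ?_ ?_, fun t ht => ?_, ?_⟩
  · rw [← Icc_union_half] at ht
    rcases ht with ht | ht
    · simpa [heq] using hleft t ht
    · simpa [heq] using hright t ht
  · refine ContinuousOn.congr (f := fun t => (z - contour L R ε t).arg + Real.pi) (fun t ht => ?_)
      fun t ht => if_pos ht.2
    exact (((Complex.continuousAt_arg (hleft t ht)).comp
      (f := fun t => z - contour L R ε t) (by fun_prop)).add_const _).continuousWithinAt
  · refine ContinuousOn.congr (f := fun t => (contour L R ε t - z).arg) (fun t ht => ?_)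
      fun t ht => ?_
    · exact ((Complex.continuousAt_arg (hright t ht)).comp
        (f := fun t => contour L R ε t - z) (by fun_prop)).continuousWithinAt
    · rcases ht.1.eq_or_lt with rfl | h1
      · simp only [le_refl, if_true]
        exact hjoin
      · exact if_neg h1.not_ge
  · beta_reduce
    split_ifs
    · push_cast
      rw [add_mul, Complex.exp_add, Complex.exp_pi_mul_I, ← mul_assoc, norm_sub_rev,
        Complex.norm_mul_exp_arg_mul_I]
      ring
    · rw [Complex.norm_mul_exp_arg_mul_I]
  · beta_reduce
    rw [if_pos (by norm_num), if_neg (by norm_num), hc0, hc1, ← neg_sub (-(R * Complex.I)) z,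
      Complex.arg_neg_eq_arg_add_pi_of_im_neg]
    · push_cast
      ring
    · simp
      linarith

/-! ### The argument principle for the characteristic function -/

/-- The image of the contour under a polynomial winds around `0` once, clockwise, for each root of the
polynomial in the open right half plane. -/
lemma IsAdmissible.encircles_aeval (h : IsAdmissible L R ε) {p : Polynomial ℝ} (hp : p ≠ 0)
    (hin : ∀ r ∈ p.aroots ℂ, 0 < r.re → ‖r‖ < R ∧ ∀ q ∈ imagAxisPoles L, ε < ‖r - q‖)
    (hne : ∀ r ∈ p.aroots ℂ, ∀ t, contour L R ε t ≠ r) :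
    Encircles (fun t => Polynomial.aeval (contour L R ε t) p) 0
      ((p.aroots ℂ).countP fun r => 0 < r.re) := by
  have h1 : Encircles (fun t => ((p.aroots ℂ).map fun r => contour L R ε t - r).prod) 0
      ((p.aroots ℂ).countP fun r => 0 < r.re) := by
    convert Encircles.multiset_prod (q := fun r : ℂ => 0 < r.re) (p.aroots ℂ) fun r hr => ?_
    split_ifs with hre
    · exact h.encircles_one hre (hin r hr hre).1 (hin r hr hre).2
    · exact h.encircles_zero (not_lt.1 hre) (hne r hr)
  have hk : (p.leadingCoeff : ℂ) ≠ 0 := by simpa using hp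
  have h2 := (encircles_const hk).mul h1
  rw [zero_add] at h2
  exact h2.congr fun t _ => (IsAlgClosed.splits _).aeval_eq_prod_aroots _

/-- The numerator of `1 + L`. It is coprime to `L.denom`, and zero only for `L = -1`. -/
noncomputable def charNum (L : RatFunc ℝ) : Polynomial ℝ := L.num + L.denom

lemma tfEval_eq (L : RatFunc ℝ) (s : ℂ) :
    tfEval L s = Polynomial.aeval s L.num / Polynomial.aeval s L.denom := rfl

lemma not_isPole_of_aeval_charNum_eq_zero {s : ℂ} (hs : Polynomial.aeval s (charNum L) = 0) :
    ¬ IsPole L s := by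
  intro h0
  have h0 : Polynomial.aeval s L.denom = 0 := h0
  have h1 : Polynomial.aeval s L.num = 0 := by rwa [charNum, map_add, h0, add_zero] at hs
  obtain ⟨a, b, hab⟩ := RatFunc.isCoprime_num_denom L
  have := congrArg (Polynomial.aeval s) hab
  simp [h0, h1] at this

lemma tfEval_add_one {s : ℂ} (hs : ¬ IsPole L s) :
    tfEval L s + 1 = Polynomial.aeval s (charNum L) * (Polynomial.aeval s L.denom)⁻¹ := by
  have : Polynomial.aeval s L.denom ≠ 0 := hs
  rw [tfEval_eq, charNum, map_add]
  field_simp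

lemma tfEval_eq_neg_one_iff {s : ℂ} :
    tfEval L s = -1 ↔ Polynomial.aeval s (charNum L) = 0 := by
  by_cases hs : IsPole L s
  · -- At a pole `tfEval` takes the junk value `0`, while the numerator of `1 + L` is nonzero.
    have h0 : Polynomial.aeval s L.denom = 0 := hs
    have h1 : Polynomial.aeval s (charNum L) ≠ 0 := fun h =>
      not_isPole_of_aeval_charNum_eq_zero h hs
    simp [tfEval_eq, h0, h1]
  · have h0 : Polynomial.aeval s L.denom ≠ 0 := hs
    rw [← add_eq_zero_iff_eq_neg, tfEval_add_one hs]
    simp [h0]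

/-- The argument principle for `1 + L`: the clockwise encirclements of `-1` are the zeros minus
the poles of `1 + L` in the right half plane. -/
lemma IsAdmissible.encircles_neg_one (h : IsAdmissible L R ε) (hp : charNum L ≠ 0)
    (hin : ∀ r ∈ (charNum L).aroots ℂ, 0 < r.re → ‖r‖ < R ∧ ∀ q ∈ imagAxisPoles L, ε < ‖r - q‖)
    (hne : ∀ t, nyquistPlot L R ε t ≠ -1) :
    Encircles (nyquistPlot L R ε) (-1)
      (((charNum L).aroots ℂ).countP (fun r => 0 < r.re) - unstablePoleCount L) := by
  have h1 := h.encircles_aeval hp hin fun r hr t ht => hne t <| tfEval_eq_neg_one_iff.2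
    (by rw [ht]; exact (Polynomial.mem_aroots.1 hr).2)
  have hε := h.eps_pos
  have h2 := h.encircles_aeval L.denom_ne_zero
    (fun r hr hre => by
      have hr : IsPole L r := (Polynomial.mem_aroots.1 hr).2
      refine ⟨by linarith [h.encloses r hr hre.le], fun q hq => ?_⟩
      rw [mem_imagAxisPoles] at hq
      have := h.separated q r hq.1 hr hq.2 hre.le (by rintro rfl; linarith)
      rw [norm_sub_rev] at this
      linarith)
    fun r hr t ht => h.not_isPole_contour t (by rw [ht]; exact (Polynomial.mem_aroots.1 hr).2)
  have h3 := h1.mul h2.inv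
  rw [← encircles_sub_iff]
  refine h3.congr fun t _ => ?_
  rw [sub_neg_eq_add]
  exact tfEval_add_one (h.not_isPole_contour t)

/-! ### One-sided signs of the imaginary part along the Nyquist plot -/

/-- `l` is the filter of one-sided punctured neighbourhoods of `t`, on the right or on the left. -/
def IsSideOf (l : Filter ℝ) (t : ℝ) : Prop := l = 𝓝[>] t ∨ l = 𝓝[<] t

namespace IsSideOf

variable {l : Filter ℝ} {t : ℝ}

lemma le_nhdsNE (h : IsSideOf l t) : l ≤ 𝓝[≠] t := by
  rcases h with rfl | rfl
  · exact nhdsGT_le_nhdsNE t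
  · exact nhdsLT_le_nhdsNE t

lemma le_nhds (h : IsSideOf l t) : l ≤ 𝓝 t := h.le_nhdsNE.trans nhdsWithin_le_nhds

lemma neBot (h : IsSideOf l t) : l.NeBot := by
  rcases h with rfl | rfl <;> infer_instance

lemma exists_isOpen_isPreconnected (h : IsSideOf l t) {p : ℝ → Prop} (hp : ∀ᶠ u in l, p u) :
    ∃ s ∈ l, IsOpen s ∧ IsPreconnected s ∧ ∀ u ∈ s, p u := by
  rcases h with rfl | rfl
  · obtain ⟨b, hb, hs⟩ := mem_nhdsGT_iff_exists_Ioo_subset.1 hp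
    exact ⟨Set.Ioo t b, Ioo_mem_nhdsGT hb, isOpen_Ioo, isPreconnected_Ioo, hs⟩
  · obtain ⟨b, hb, hs⟩ := mem_nhdsLT_iff_exists_Ioo_subset.1 hp
    exact ⟨Set.Ioo b t, Ioo_mem_nhdsLT hb, isOpen_Ioo, isPreconnected_Ioo, hs⟩

end IsSideOf

/-- The real function `f` has a constant sign along the filter `l`. -/
def SignedAlong (f : ℝ → ℝ) (l : Filter ℝ) : Prop :=
  (∀ᶠ u in l, 0 < f u) ∨ (∀ᶠ u in l, f u = 0) ∨ ∀ᶠ u in l, f u < 0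

lemma IsSideOf.signedAlong {l : Filter ℝ} {t : ℝ} (h : IsSideOf l t) {f : ℝ → ℝ}
    (hf : Continuous f) (hd : (∀ᶠ u in l, f u = 0) ∨ ∀ᶠ u in l, f u ≠ 0) : SignedAlong f l := by
  rcases hd with hd | hd
  · exact Or.inr (Or.inl hd)
  · obtain ⟨s, hs, -, hc, hne⟩ := h.exists_isOpen_isPreconnected hd
    by_cases hpos : ∃ u ∈ s, 0 < f u
    · obtain ⟨u, hu, hu0⟩ := hpos
      refine Or.inl (mem_of_superset hs fun v hv => ?_)
      by_contra hv0
      obtain ⟨x, hx, hx0⟩ := hc.intermediate_value hv hu hf.continuousOn ⟨not_lt.1 hv0, hu0.le⟩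
      exact hne x hx hx0
    · push Not at hpos
      exact Or.inr (Or.inr (mem_of_superset hs fun v hv => (hpos v hv).lt_of_ne (hne v hv)))

lemma analyticAt_im_tfEval {c : ℝ → ℂ} {x₀ : ℝ} (hc : AnalyticAt ℝ c x₀)
    (hx₀ : ¬ IsPole L (c x₀)) : AnalyticAt ℝ (fun x => (tfEval L (c x)).im) x₀ :=
  (Complex.imCLM.analyticAt _).comp ((hc.aeval_polynomial L.num).div
    (hc.aeval_polynomial L.denom) hx₀)

/-- Along a reparametrized analytic curve, `Im L` either vanishes identically or has no zeros on a
punctured neighbourhood. -/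
lemma eventually_im_tfEval {c : ℝ → ℂ} {x₀ : ℝ} (hc : AnalyticAt ℝ c x₀)
    (hx₀ : ¬ IsPole L (c x₀)) {l : Filter ℝ} {φ : ℝ → ℝ} (hφ : Tendsto φ l (𝓝[≠] x₀)) :
    (∀ᶠ u in l, (tfEval L (c (φ u))).im = 0) ∨ ∀ᶠ u in l, (tfEval L (c (φ u))).im ≠ 0 :=
  (analyticAt_im_tfEval hc hx₀).eventually_eq_zero_or_eventually_ne_zero.imp
    (fun h => (hφ.mono_right nhdsWithin_le_nhds).eventually h) fun h => hφ.eventually h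

lemma analyticAt_add_mul_exp (p : ℂ) (r x : ℝ) :
    AnalyticAt ℝ (fun x : ℝ => p + r * Complex.exp (x * Complex.I)) x := by
  have h1 : AnalyticAt ℝ (fun x : ℝ => (x : ℂ) * Complex.I) x :=
    (Complex.ofRealCLM.analyticAt x).mul analyticAt_const
  exact analyticAt_const.add (analyticAt_const.mul
    ((analyticAt_cexp.restrictScalars (𝕜 := ℝ)).comp h1))

/-- A small semicircle, parametrized by its polar angle. -/
lemma mk_sqrt_eq_add_mul_exp_arcsin {p : ℂ} (hp : p.re = 0) (hε : 0 < ε) {y : ℝ}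
    (hy : |y - p.im| ≤ ε) : (⟨√(ε ^ 2 - (y - p.im) ^ 2), y⟩ : ℂ) =
      p + ε * Complex.exp (Real.arcsin ((y - p.im) / ε) * Complex.I) := by
  have hv : |(y - p.im) / ε| ≤ 1 := by rwa [abs_div, abs_of_pos hε, div_le_one hε]
  rw [abs_le] at hv
  apply Complex.ext
  · rw [Complex.add_re, Complex.re_ofReal_mul, Complex.exp_ofReal_mul_I_re, Real.cos_arcsin, hp,
      zero_add]
    nth_rewrite 2 [← Real.sqrt_sq hε.le]
    rw [← Real.sqrt_mul (sq_nonneg _)]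
    field_simp
  · rw [Complex.add_im, Complex.im_ofReal_mul, Complex.exp_ofReal_mul_I_im,
      Real.sin_arcsin hv.1 hv.2]
    field_simp
    ring

lemma IsSideOf.tendsto_affine {l : Filter ℝ} {t : ℝ} (h : IsSideOf l t) {a : ℝ} (ha : a ≠ 0)
    (b : ℝ) : Tendsto (fun u => a * u + b) l (𝓝[≠] (a * t + b)) := by
  refine tendsto_nhdsWithin_iff.2 ⟨?_, ?_⟩
  · exact (Continuous.tendsto (by fun_prop) t).mono_left h.le_nhds
  · filter_upwards [h.le_nhdsNE self_mem_nhdsWithin] with u hu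
    simpa [ha] using hu

/-- On one side of `t`, the height of the contour stays either in a given closed interval or outside
its interior. -/
lemma IsSideOf.le_or_ge_along {l : Filter ℝ} {t : ℝ} (h : IsSideOf l t) (r m : ℝ) :
    (∀ᶠ u in l, |R * (4 * u - 1) - m| ≤ r) ∨ ∀ᶠ u in l, r ≤ |R * (4 * u - 1) - m| := by
  by_cases hr : r ≤ 0
  · exact Or.inr (Eventually.of_forall fun u => hr.trans (abs_nonneg _))
  have hr : 0 ≤ r := (not_le.1 hr).le
  have han : AnalyticAt ℝ (fun u => r ^ 2 - (R * (4 * u - 1) - m) ^ 2) t := by fun_prop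
  have hs : SignedAlong (fun u => r ^ 2 - (R * (4 * u - 1) - m) ^ 2) l :=
    h.signedAlong (by fun_prop) (han.eventually_eq_zero_or_eventually_ne_zero.imp
      (fun h' => h.le_nhds h') fun h' => h.le_nhdsNE h')
  have hle : ∀ {u : ℝ}, 0 ≤ r ^ 2 - (R * (4 * u - 1) - m) ^ 2 → |R * (4 * u - 1) - m| ≤ r :=
    fun hu => abs_le_of_sq_le_sq (by linarith) hr
  rcases hs with hs | hs | hs
  · exact Or.inl (hs.mono fun u hu => hle hu.le)
  · exact Or.inl (hs.mono fun u hu => hle hu.ge)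
  · refine Or.inr (hs.mono fun u hu => ?_)
    rw [← abs_of_nonneg hr]
    exact sq_le_sq.1 (by linarith)

/-- On the indented axis the contour is locally, on each side, an analytic arc: a piece of a small
semicircle or of the axis itself. The polar angle is used on the semicircles because the height is not
an analytic parameter at their ends. -/
lemma IsAdmissible.eventually_im_left (h : IsAdmissible L R ε) {l : Filter ℝ} {t : ℝ}
    (hl : IsSideOf l t) (hmem : Set.Icc 0 (1 / 2) ∈ l) :
    (∀ᶠ u in l, (nyquistPlot L R ε u).im = 0) ∨ ∀ᶠ u in l, (nyquistPlot L R ε u).im ≠ 0 := by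
  have := hl.neBot
  have ht : t ∈ Set.Icc (0 : ℝ) (1 / 2) :=
    isClosed_Icc.mem_of_tendsto (hl.le_nhds : Tendsto id l (𝓝 t)) hmem
  have hcont : ∀ {u}, u ∈ Set.Icc (0 : ℝ) (1 / 2) → contour L R ε u =
      ⟨indentation L ε (R * (4 * u - 1)), R * (4 * u - 1)⟩ := fun hu => by
    rw [h.contour_eq ⟨hu.1, hu.2.trans (by norm_num)⟩, contourBase_of_le hu.2]
  by_cases hp : ∃ p ∈ imagAxisPoles L, ∀ᶠ u in l, |R * (4 * u - 1) - p.im| ≤ ε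
  · obtain ⟨p, hp, hu⟩ := hp
    have ht' : |R * (4 * t - 1) - p.im| ≤ ε :=
      le_of_tendsto ((Continuous.tendsto (by fun_prop) t).mono_left hl.le_nhds) hu
    have hcurve : ∀ {u}, u ∈ Set.Icc (0 : ℝ) (1 / 2) → |R * (4 * u - 1) - p.im| ≤ ε →
        contour L R ε u =
          p + ε * Complex.exp (Real.arcsin ((R * (4 * u - 1) - p.im) / ε) * Complex.I) := by
      intro u hu hu'
      rw [hcont hu, h.indentation_eq_sqrt hp hu',
        mk_sqrt_eq_add_mul_exp_arcsin (mem_imagAxisPoles.1 hp).2 h.eps_pos hu']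
    have hφ : Tendsto (fun u => Real.arcsin ((R * (4 * u - 1) - p.im) / ε)) l
        (𝓝[≠] Real.arcsin ((R * (4 * t - 1) - p.im) / ε)) := by
      refine tendsto_nhdsWithin_iff.2 ⟨?_, ?_⟩
      · exact (Continuous.tendsto (Real.continuous_arcsin.comp (by fun_prop)) t).mono_left
          hl.le_nhds
      · have hmaps : ∀ {u}, |R * (4 * u - 1) - p.im| ≤ ε →
            (R * (4 * u - 1) - p.im) / ε ∈ Set.Icc (-1 : ℝ) 1 := fun hu => by
          rw [Set.mem_Icc, ← abs_le, abs_div, abs_of_pos h.eps_pos, div_le_one h.eps_pos]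
          exact hu
        filter_upwards [hu, hl.le_nhdsNE self_mem_nhdsWithin] with u hu hne heq
        have := Real.injOn_arcsin (hmaps hu) (hmaps ht') heq
        rw [div_left_inj' h.eps_pos.ne', sub_left_inj, mul_right_inj' h.radius_pos.ne'] at this
        exact hne (by simpa using this)
    refine (eventually_im_tfEval (L := L) (analyticAt_add_mul_exp p ε _) ?_ hφ).imp ?_ ?_
    · rw [← hcurve ht ht']
      exact h.not_isPole_contour t
    all_goals
      intro hev
      filter_upwards [hev, hu, hmem] with u h1 h2 h3
      rwa [nyquistPlot, hcurve h3 h2]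
  · have hp' : ∀ p ∈ imagAxisPoles L, ∀ᶠ u in l, ε ≤ |R * (4 * u - 1) - p.im| := fun p hp1 =>
      (hl.le_or_ge_along ε p.im).resolve_left fun h2 => hp ⟨p, hp1, h2⟩
    have hu := (eventually_all_finset (imagAxisPoles L)).2 hp'
    have ht' : ∀ p ∈ imagAxisPoles L, ε ≤ |R * (4 * t - 1) - p.im| := fun p hp1 =>
      ge_of_tendsto ((Continuous.tendsto (by fun_prop) t).mono_left hl.le_nhds) (hp' p hp1)
    have hcurve : ∀ {u}, u ∈ Set.Icc (0 : ℝ) (1 / 2) →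
        (∀ p ∈ imagAxisPoles L, ε ≤ |R * (4 * u - 1) - p.im|) →
        contour L R ε u = ((4 * R * u + -R : ℝ) : ℂ) * Complex.I := by
      intro u hu hu'
      rw [hcont hu, indentation_eq_zero h.eps_pos.le hu']
      apply Complex.ext
      · simp
      · simp
        ring
    refine (eventually_im_tfEval (L := L) (c := fun x : ℝ => (x : ℂ) * Complex.I)
      ((Complex.ofRealCLM.analyticAt _).mul analyticAt_const) ?_
      (hl.tendsto_affine (mul_ne_zero four_ne_zero h.radius_pos.ne') (-R))).imp ?_ ?_
    · rw [← hcurve ht ht']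
      exact h.not_isPole_contour t
    all_goals
      intro hev
      filter_upwards [hev, hu, hmem] with u h1 h2 h3
      rwa [nyquistPlot, hcurve h3 h2]

lemma IsAdmissible.eventually_im_right (h : IsAdmissible L R ε) {l : Filter ℝ} {t : ℝ}
    (hl : IsSideOf l t) (hmem : Set.Icc (1 / 2) 1 ∈ l) :
    (∀ᶠ u in l, (nyquistPlot L R ε u).im = 0) ∨ ∀ᶠ u in l, (nyquistPlot L R ε u).im ≠ 0 := by
  have := hl.neBot
  have ht : t ∈ Set.Icc (1 / 2 : ℝ) 1 :=
    isClosed_Icc.mem_of_tendsto (hl.le_nhds : Tendsto id l (𝓝 t)) hmem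
  have hcurve : ∀ {u}, u ∈ Set.Icc (1 / 2 : ℝ) 1 → contour L R ε u =
      0 + R * Complex.exp ((-(2 * Real.pi) * u + Real.pi * (3 / 2) : ℝ) * Complex.I) := by
    intro u hu
    rw [h.contour_eq ⟨le_trans (by norm_num) hu.1, hu.2⟩, h.contourBase_of_ge hu.1, zero_add]
    congr 4
    ring
  refine (eventually_im_tfEval (L := L) (analyticAt_add_mul_exp 0 R _) ?_
    (hl.tendsto_affine (neg_ne_zero.2 Real.two_pi_pos.ne') (Real.pi * (3 / 2)))).imp ?_ ?_
  · rw [← hcurve ht]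
    exact h.not_isPole_contour t
  all_goals
    intro hev
    filter_upwards [hev, hmem] with u h1 h2
    rwa [nyquistPlot, hcurve h2]

lemma IsAdmissible.continuous_nyquistPlot (h : IsAdmissible L R ε) :
    Continuous (nyquistPlot L R ε) := by
  have hc := h.continuous_contour
  refine Continuous.div ((Polynomial.continuous_aeval L.num).comp hc)
    ((Polynomial.continuous_aeval L.denom).comp hc) h.not_isPole_contour

lemma IsSideOf.half_mem {l : Filter ℝ} {t : ℝ} (hl : IsSideOf l t) (hmem : Set.Icc 0 1 ∈ l) :
    Set.Icc 0 (1 / 2) ∈ l ∨ Set.Icc (1 / 2) 1 ∈ l := by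
  rcases hl with rfl | rfl
  · rcases lt_or_ge t (1 / 2) with ht | ht
    · left
      filter_upwards [hmem, Ioo_mem_nhdsGT ht] with u h1 h2 using ⟨h1.1, h2.2.le⟩
    · right
      filter_upwards [hmem, self_mem_nhdsWithin] with u h1 h2 using ⟨ht.trans (le_of_lt h2), h1.2⟩
  · rcases le_or_gt t (1 / 2) with ht | ht
    · left
      filter_upwards [hmem, self_mem_nhdsWithin] with u h1 h2 using ⟨h1.1, le_trans (le_of_lt h2) ht⟩
    · right
      filter_upwards [hmem, Ioo_mem_nhdsLT ht] with u h1 h2 using ⟨h2.1.le, h1.2⟩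

lemma IsAdmissible.signedAlong_im (h : IsAdmissible L R ε) {l : Filter ℝ} {t : ℝ}
    (hl : IsSideOf l t) (hmem : Set.Icc 0 1 ∈ l) :
    SignedAlong (fun u => (nyquistPlot L R ε u).im) l := by
  refine hl.signedAlong (Complex.continuous_im.comp h.continuous_nyquistPlot) ?_
  rcases hl.half_mem hmem with hm | hm
  · exact h.eventually_im_left hl hm
  · exact h.eventually_im_right hl hm

/-! ### The Nichols chart near the critical ray -/

lemma lt_phaseDeg_of_im_neg {z : ℂ} (hz : z.im < 0) : -180 < phaseDeg z := by
  have h1 : z.arg * 180 / Real.pi < 0 :=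
    div_neg_of_neg_of_pos (by linarith [Complex.arg_neg_iff.2 hz]) Real.pi_pos
  have h2 : -180 < z.arg * 180 / Real.pi := by
    rw [lt_div_iff₀ Real.pi_pos]
    linarith [Complex.neg_pi_lt_arg z]
  have h3 : phaseDeg z = z.arg * 180 / Real.pi :=
    (toIcoMod_eq_self _).2 ⟨by linarith, by linarith⟩
  rwa [h3]

lemma phaseDeg_of_im_nonneg {z : ℂ} (hz : 0 ≤ z.im) :
    phaseDeg z = z.arg * 180 / Real.pi - 360 := by
  have h1 : 0 ≤ z.arg * 180 / Real.pi :=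
    div_nonneg (by linarith [Complex.arg_nonneg_iff.2 hz]) Real.pi_pos.le
  have h2 : z.arg * 180 / Real.pi ≤ 180 := by
    rw [div_le_iff₀ Real.pi_pos]
    linarith [Complex.arg_le_pi z]
  exact (toIcoMod_eq_iff _).2 ⟨⟨by linarith, by linarith⟩, 1, by simp⟩

lemma phaseDeg_eq_iff {z : ℂ} : phaseDeg z = -180 ↔ z.re < 0 ∧ z.im = 0 := by
  rw [← Complex.arg_eq_pi_iff]
  have hpi := Real.pi_pos
  rcases lt_or_ge z.im 0 with hz | hz
  · have h1 := Complex.arg_neg_iff.2 hz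
    exact ⟨fun h => absurd h (lt_phaseDeg_of_im_neg hz).ne', fun h => by linarith⟩
  · rw [phaseDeg_of_im_nonneg hz]
    constructor
    · intro h
      have h1 : z.arg * 180 / Real.pi = 180 := by linarith
      rw [div_eq_iff hpi.ne'] at h1
      linarith
    · intro h
      rw [h]
      field_simp
      norm_num

lemma phaseDeg_lt_of_im_pos {z : ℂ} (hz : 0 < z.im) : phaseDeg z < -180 := by
  have h1 : z.arg < Real.pi := lt_of_le_of_ne (Complex.arg_le_pi z) fun h =>
    hz.ne' (Complex.arg_eq_pi_iff.1 h).2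
  have h2 : z.arg * 180 / Real.pi < 180 := by
    rw [div_lt_iff₀ Real.pi_pos]
    linarith
  rw [phaseDeg_of_im_nonneg hz.le]
  linarith

lemma magDB_of_ne_zero {z : ℂ} (hz : z ≠ 0) :
    magDB z = ((20 * Real.logb 10 ‖z‖ : ℝ) : EReal) := if_neg hz

lemma magDB_pos_iff {z : ℂ} (hz : z ≠ 0) : 0 < magDB z ↔ 1 < ‖z‖ := by
  rw [magDB_of_ne_zero hz, EReal.coe_pos, ← Real.logb_pos_iff (b := 10) (by norm_num)
    (norm_pos_iff.2 hz)]
  constructor <;> intro h <;> linarith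

lemma norm_eq_neg_re {z : ℂ} (hre : z.re < 0) (him : z.im = 0) : ‖z‖ = -z.re := by
  rw [← Complex.abs_re_eq_norm.2 him, abs_of_neg hre]

lemma nicholsMap_mem_criticalRay_iff {z : ℂ} :
    nicholsMap z ∈ criticalRay ↔ z.re < -1 ∧ z.im = 0 := by
  change phaseDeg z = -180 ∧ 0 < magDB z ↔ _
  rw [phaseDeg_eq_iff]
  constructor
  · rintro ⟨⟨h1, h2⟩, h3⟩
    rw [magDB_pos_iff (by rintro rfl; simp at h1), norm_eq_neg_re h1 h2] at h3
    exact ⟨by linarith, h2⟩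
  · rintro ⟨h1, h2⟩
    have h0 : z.re < 0 := by linarith
    refine ⟨⟨h0, h2⟩, ?_⟩
    rw [magDB_pos_iff (by rintro rfl; simp at h0), norm_eq_neg_re h0 h2]
    linarith

lemma nicholsMap_eq_criticalPoint_iff {z : ℂ} : nicholsMap z = criticalPoint ↔ z = -1 := by
  rw [nicholsMap, criticalPoint, Prod.mk.injEq, phaseDeg_eq_iff]
  constructor
  · rintro ⟨⟨h1, h2⟩, h3⟩
    have hz : z ≠ 0 := by rintro rfl; simp at h1
    rw [magDB_of_ne_zero hz, EReal.coe_eq_zero, norm_eq_neg_re h1 h2] at h3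
    have h4 : Real.logb 10 (-z.re) = 0 := by linarith
    rw [Real.logb_eq_zero] at h4
    apply Complex.ext
    · rw [Complex.neg_re, Complex.one_re]
      norm_num at h4
      rcases h4 with h4 | h4 | h4 <;> linarith
    · simpa using h2
  · rintro rfl
    rw [magDB_of_ne_zero (by simp)]
    simp

lemma side_eq_one {c : ℝ → ℝ × EReal} {l : Filter ℝ} (h : ∀ᶠ u in l, (c u).1 < -180) :
    side c l = 1 := if_pos h

lemma side_eq_neg_one {c : ℝ → ℝ × EReal} {l : Filter ℝ} [l.NeBot]
    (h : ∀ᶠ u in l, -180 < (c u).1) : side c l = -1 := by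
  rw [side, if_neg, if_pos h]
  intro h'
  obtain ⟨u, h1, h2⟩ := (h.and h').exists
  exact lt_asymm h1 h2

lemma side_eq_zero {c : ℝ → ℝ × EReal} {l : Filter ℝ} [l.NeBot]
    (h : ∀ᶠ u in l, (c u).1 = -180) : side c l = 0 := by
  rw [side, if_neg, if_neg]
  all_goals
    intro h'
    obtain ⟨u, h1, h2⟩ := (h.and h').exists
    linarith

open Classical in
/-- The contribution to the signed crossing at `t` of the side `l` of `t`. -/
noncomputable def halfCrossing (c : ℝ → ℝ × EReal) (l : Filter ℝ) (t : ℝ) : ℚ :=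
  if c t ∈ criticalRay then side c l / 2 else 0

lemma crossingSign_eq_sub (c : ℝ → ℝ × EReal) (t : ℝ) :
    crossingSign c t = halfCrossing c (𝓝[>] t) t - halfCrossing c (𝓝[<] t) t := by
  unfold crossingSign halfCrossing
  split_ifs <;> ring

/-- The left-hand side of the parameter `0` is that of `1`, for a curve of period `1`. -/
lemma halfCrossing_left_periodic {c : ℝ → ℝ × EReal} (hc : ∀ t, c (t + 1) = c t) :
    halfCrossing c (𝓝[<] 1) 1 = halfCrossing c (𝓝[<] 0) 0 := by
  have hmap : map (fun u : ℝ => u + 1) (𝓝[<] 0) = 𝓝[<] 1 := by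
    simpa only [Homeomorph.coe_addRight, Set.image_add_const_Iio, zero_add] using
      (Homeomorph.addRight (1 : ℝ)).isEmbedding.map_nhdsWithin_eq (Set.Iio 0) 0
  have h1 : c 1 = c 0 := by rw [← hc 0, zero_add]
  have hev : ∀ p : ℝ × EReal → Prop, (∀ᶠ u in 𝓝[<] 1, p (c u)) ↔ ∀ᶠ u in 𝓝[<] 0, p (c u) :=
    fun p => by simp only [← hmap, eventually_map, hc]
  have hside : side c (𝓝[<] 1) = side c (𝓝[<] 0) := by
    classical
    exact if_congr (hev fun a => a.1 < -180) rfl (if_congr (hev fun a => -180 < a.1) rfl rfl)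
  rw [halfCrossing, halfCrossing, h1, hside]

/-! ### Crossings as jumps of the sheet number -/

section Curve

variable {z : ℝ → ℂ}

/-- Near a point with one-sided signs of `Im z` there are no signed crossings. -/
lemma IsSideOf.eventually_halfCrossing_eq_zero {l : Filter ℝ} {t : ℝ} (hl : IsSideOf l t)
    (hz : Continuous z) (hs : SignedAlong (fun u => (z u).im) l) :
    ∀ᶠ u in l, ∀ l', IsSideOf l' u → halfCrossing (fun s => nicholsMap (z s)) l' u = 0 := by
  have hoff : ∀ u, (z u).im ≠ 0 → ∀ l', IsSideOf l' u →
      halfCrossing (fun s => nicholsMap (z s)) l' u = 0 := fun u hu l' _ =>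
    if_neg fun h => hu (nicholsMap_mem_criticalRay_iff.1 h).2
  rcases hs with hs | hs | hs
  · exact hs.mono fun u hu => hoff u hu.ne'
  · obtain ⟨s, hs, ho, -, hz0⟩ := hl.exists_isOpen_isPreconnected hs
    refine mem_of_superset hs fun u hu l' hl' => ?_
    by_cases hray : nicholsMap (z u) ∈ criticalRay
    · have := hl'.neBot
      have hre : ∀ᶠ v in 𝓝 u, (z v).re < -1 :=
        (Complex.continuous_re.comp hz).continuousAt.eventually_lt_const
          (nicholsMap_mem_criticalRay_iff.1 hray).1
      have hside : side (fun s => nicholsMap (z s)) l' = 0 := by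
        refine side_eq_zero ?_
        filter_upwards [hl'.le_nhds hre, hl'.le_nhds (ho.mem_nhds hu)] with v h1 h2
        exact phaseDeg_eq_iff.2 ⟨by linarith, hz0 v h2⟩
      rw [halfCrossing, hside]
      simp
    · exact if_neg hray
  · exact hs.mono fun u hu => hoff u hu.ne

/-- The number of the sheet, between two consecutive odd multiples of `π`, that contains the angle
`φ`: a half-integer inside a sheet, and the integer `k` on the boundary angle `(2 * k + 1) * π`. -/
noncomputable def sheet (φ : ℝ) : ℚ :=
  (⌊(φ - Real.pi) / (2 * Real.pi)⌋ + ⌈(φ - Real.pi) / (2 * Real.pi)⌉) / 2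

lemma sheet_boundary {φ : ℝ} {k : ℤ} (h : φ = Real.pi + 2 * Real.pi * k) : sheet φ = k := by
  have : (φ - Real.pi) / (2 * Real.pi) = k := by
    rw [h]
    field_simp
    ring
  rw [sheet, this, Int.floor_intCast, Int.ceil_intCast]
  ring

lemma sheet_interior {φ : ℝ} {k : ℤ} (h₁ : Real.pi + 2 * Real.pi * k < φ)
    (h₂ : φ < Real.pi + 2 * Real.pi * (k + 1)) : sheet φ = k + 1 / 2 := by
  have hp := Real.two_pi_pos
  have hf : ⌊(φ - Real.pi) / (2 * Real.pi)⌋ = k := by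
    rw [Int.floor_eq_iff, le_div_iff₀ hp, div_lt_iff₀ hp]
    constructor <;> linarith
  have hc : ⌈(φ - Real.pi) / (2 * Real.pi)⌉ = k + 1 := by
    rw [Int.ceil_eq_iff, lt_div_iff₀ hp, div_le_iff₀ hp]
    push_cast
    constructor <;> linarith
  rw [sheet, hf, hc]
  push_cast
  ring

lemma sheet_add (φ : ℝ) (N : ℤ) : sheet (φ + 2 * Real.pi * N) = sheet φ + N := by
  have : (φ + 2 * Real.pi * N - Real.pi) / (2 * Real.pi) = (φ - Real.pi) / (2 * Real.pi) + N := by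
    field_simp
    ring
  rw [sheet, sheet, this, Int.floor_add_intCast, Int.ceil_add_intCast]
  push_cast
  ring

lemma exists_boundary_or_interior (φ : ℝ) : ∃ k : ℤ, φ = Real.pi + 2 * Real.pi * k ∨
    Real.pi + 2 * Real.pi * k < φ ∧ φ < Real.pi + 2 * Real.pi * (k + 1) := by
  have hp := Real.two_pi_pos
  refine ⟨⌊(φ - Real.pi) / (2 * Real.pi)⌋, ?_⟩
  have h1 := Int.floor_le ((φ - Real.pi) / (2 * Real.pi))
  have h2 := Int.lt_floor_add_one ((φ - Real.pi) / (2 * Real.pi))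
  rw [le_div_iff₀ hp] at h1
  rw [div_lt_iff₀ hp] at h2
  rcases h1.eq_or_lt with h | h
  · left; linarith
  · right; constructor <;> linarith

/-- The half crossing on one side of `t` is the jump of the sheet number of the argument of `z + 1`
on that side. -/
lemma IsSideOf.eventually_sheet_eq {l : Filter ℝ} {t : ℝ} (hl : IsSideOf l t) {θ : ℝ → ℝ}
    (hθ : Tendsto θ l (𝓝 (θ t))) (ht : z t ≠ -1)
    (hzt : z t + 1 = (‖z t + 1‖ : ℂ) * Complex.exp ((θ t : ℂ) * Complex.I))
    (hzl : ∀ᶠ u in l, z u ≠ -1 ∧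
      z u + 1 = (‖z u + 1‖ : ℂ) * Complex.exp ((θ u : ℂ) * Complex.I))
    (hs : SignedAlong (fun u => (z u).im) l) :
    ∀ᶠ u in l, sheet (θ u) = sheet (θ t) - halfCrossing (fun s => nicholsMap (z s)) l t := by
  have := hl.neBot
  have hpi := Real.pi_pos
  have hre : ∀ {u}, z u + 1 = (‖z u + 1‖ : ℂ) * Complex.exp ((θ u : ℂ) * Complex.I) →
      (z u).re + 1 = ‖z u + 1‖ * Real.cos (θ u) := fun hu => by
    have := congrArg Complex.re hu
    rwa [Complex.re_ofReal_mul, Complex.exp_ofReal_mul_I_re, Complex.add_re, Complex.one_re] at this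
  have him : ∀ {u}, z u + 1 = (‖z u + 1‖ : ℂ) * Complex.exp ((θ u : ℂ) * Complex.I) →
      (z u).im = ‖z u + 1‖ * Real.sin (θ u) := fun hu => by
    have := congrArg Complex.im hu
    rwa [Complex.im_ofReal_mul, Complex.exp_ofReal_mul_I_im, Complex.add_im, Complex.one_im,
      add_zero] at this
  have hpos : ∀ {u}, z u ≠ -1 → 0 < ‖z u + 1‖ := fun hu =>
    norm_pos_iff.2 fun h => hu (add_eq_zero_iff_eq_neg.1 h)
  obtain ⟨k, hk | ⟨hk1, hk2⟩⟩ := exists_boundary_or_interior (θ t)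
  · -- The angle is a boundary angle, so `z t` lies on the ray.
    have hcos : Real.cos (θ t) = -1 := by
      rw [hk, mul_comm (2 * Real.pi), Real.cos_add_int_mul_two_pi, Real.cos_pi]
    have hsin : Real.sin (θ t) = 0 := by
      rw [hk, mul_comm (2 * Real.pi), Real.sin_add_int_mul_two_pi, Real.sin_pi]
    have h1 := hre hzt
    have h2 := him hzt
    rw [hcos] at h1
    rw [hsin, mul_zero] at h2
    have hray : nicholsMap (z t) ∈ criticalRay :=
      nicholsMap_mem_criticalRay_iff.2 ⟨by linarith [hpos ht], h2⟩
    have hnear : ∀ᶠ u in l, θ t - Real.pi < θ u ∧ θ u < θ t + Real.pi :=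
      (hθ.eventually_const_lt (by linarith)).and (hθ.eventually_lt_const (by linarith))
    have hshift : ∀ u, Real.sin (θ u) = -Real.sin (θ u - θ t) := fun u => by
      rw [hk, ← sub_sub, mul_comm (2 * Real.pi), Real.sin_sub_int_mul_two_pi, Real.sin_sub_pi,
        neg_neg]
    have hhalf : halfCrossing (fun s => nicholsMap (z s)) l t =
        side (fun s => nicholsMap (z s)) l / 2 := if_pos hray
    rw [hhalf, sheet_boundary hk]
    rcases hs with hs | hs | hs
    · rw [side_eq_one (hs.mono fun u hu => phaseDeg_lt_of_im_pos hu)]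
      filter_upwards [hs, hnear, hzl] with u hu hn hu'
      have hlt : θ u < θ t := by
        by_contra! hge
        rw [him hu'.2, hshift] at hu
        have := Real.sin_nonneg_of_nonneg_of_le_pi (sub_nonneg.2 hge) (by linarith)
        nlinarith [hpos hu'.1]
      rw [sheet_interior (k := k - 1)]
      · push_cast
        ring
      · push_cast
        linarith
      · push_cast
        linarith
    · have hθu : ∀ᶠ u in l, θ u = θ t := by
        filter_upwards [hs, hnear, hzl] with u hu hn hu'
        rw [him hu'.2, hshift] at hu
        have h3 : Real.sin (θ u - θ t) = 0 := by
          rcases mul_eq_zero.1 hu with h | h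
          · exact absurd h (hpos hu'.1).ne'
          · linarith
        rw [Real.sin_eq_zero_iff_of_lt_of_lt (by linarith) (by linarith)] at h3
        linarith
      have hside : side (fun s => nicholsMap (z s)) l = 0 := by
        refine side_eq_zero ?_
        filter_upwards [hs, hθu, hzl] with u hu h3 hu'
        refine phaseDeg_eq_iff.2 ⟨?_, hu⟩
        have h4 := hre hu'.2
        rw [h3, hcos] at h4
        linarith [hpos hu'.1]
      rw [hside]
      filter_upwards [hθu] with u hu
      rw [hu, sheet_boundary hk]
      ring
    · rw [side_eq_neg_one (hs.mono fun u hu => lt_phaseDeg_of_im_neg hu)]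
      filter_upwards [hs, hnear, hzl] with u hu hn hu'
      have hlt : θ t < θ u := by
        by_contra! hge
        rw [him hu'.2, hshift] at hu
        have := Real.sin_nonpos_of_nonpos_of_neg_pi_le (sub_nonpos.2 hge) (by linarith)
        nlinarith [hpos hu'.1]
      rw [sheet_interior (k := k)]
      · ring
      · linarith
      · linarith
  · -- The angle is interior to a sheet, and `z t` is off the ray.
    have hray : nicholsMap (z t) ∉ criticalRay := by
      intro h
      rw [nicholsMap_mem_criticalRay_iff] at h
      have h1 := hre hzt
      have h2 := him hzt
      rw [h.2] at h2
      have h3 : Real.sin (θ t) = 0 := by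
        rcases mul_eq_zero.1 h2.symm with h | h
        · exact absurd h (hpos ht).ne'
        · exact h
      have h5 : Real.sin (θ t - (Real.pi + 2 * Real.pi * k + Real.pi)) = 0 := by
        rw [show θ t - (Real.pi + 2 * Real.pi * k + Real.pi) = θ t - ((k + 1 : ℤ) : ℝ) *
          (2 * Real.pi) by push_cast; ring, Real.sin_sub_int_mul_two_pi, h3]
      rw [Real.sin_eq_zero_iff_of_lt_of_lt (by linarith) (by linarith)] at h5
      have h6 : Real.cos (θ t) = 1 := by
        rw [show θ t = ((k + 1 : ℤ) : ℝ) * (2 * Real.pi) by push_cast; linarith,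
          Real.cos_int_mul_two_pi]
      rw [h6] at h1
      linarith [hpos ht]
    have hhalf : halfCrossing (fun s => nicholsMap (z s)) l t = 0 := if_neg hray
    rw [hhalf, sub_zero, sheet_interior hk1 hk2]
    filter_upwards [hθ.eventually_const_lt hk1, hθ.eventually_lt_const hk2] with u h1 h2
    exact sheet_interior h1 h2

end Curve

/-! ### Summation of jumps -/

/-- A function that is locally constant on `[0, 1]` takes the same value at `0` and at `1`. -/
lemma eq_of_eventually_eq_sides {α : Type*} {D : ℝ → α}
    (hr : ∀ t ∈ Set.Ico (0 : ℝ) 1, ∀ᶠ u in 𝓝[>] t, D u = D t)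
    (hl : ∀ t ∈ Set.Ioc (0 : ℝ) 1, ∀ᶠ u in 𝓝[<] t, D u = D t) : D 1 = D 0 := by
  have hcl : IsClosed ({s | D s = D 0} ∩ Set.Icc 0 1) := by
    refine isClosed_of_closure_subset fun t ht => ?_
    have htI : t ∈ Set.Icc (0 : ℝ) 1 :=
      closure_minimal Set.inter_subset_right isClosed_Icc ht
    refine ⟨?_, htI⟩
    rw [mem_closure_iff_frequently] at ht
    have hev : ∀ᶠ u in 𝓝 t, u ∈ Set.Icc (0 : ℝ) 1 → D u = D t := by
      rw [← nhdsNE_sup_pure, ← nhdsLT_sup_nhdsGT, eventually_sup, eventually_sup]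
      refine ⟨⟨?_, ?_⟩, fun _ => rfl⟩
      · rcases htI.1.eq_or_lt with rfl | h0
        · filter_upwards [self_mem_nhdsWithin] with u hu hu'
          exact absurd hu'.1 (not_le.2 hu)
        · exact (hl t ⟨h0, htI.2⟩).mono fun u hu _ => hu
      · rcases htI.2.eq_or_lt with rfl | h0
        · filter_upwards [self_mem_nhdsWithin] with u hu hu'
          exact absurd hu'.2 (not_le.2 hu)
        · exact (hr t ⟨htI.1, h0⟩).mono fun u hu _ => hu
    obtain ⟨u, hu, hu'⟩ := (ht.and_eventually hev).exists
    exact (hu' hu.2).symm.trans hu.1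
  have := hcl.Icc_subset_of_forall_mem_nhdsWithin (a := 0) (b := 1) rfl fun t ht =>
    (hr t ht.2).mono fun u hu => hu.trans ht.1
  exact this (Set.right_mem_Icc.2 zero_le_one)

open Function in
/-- If the one-sided jumps of `g` at `t` are `g t - g (t+) = A t` and `g t - g (t-) = B t`, then the
jumps add up to the total change of `g`. -/
lemma finsum_jumps {A B g : ℝ → ℚ} (hA : (Set.Icc 0 1 ∩ support A).Finite)
    (hB : (Set.Icc 0 1 ∩ support B).Finite)
    (hr : ∀ t ∈ Set.Ico (0 : ℝ) 1, ∀ᶠ u in 𝓝[>] t, A u = 0 ∧ B u = 0 ∧ g u = g t - A t)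
    (hl : ∀ t ∈ Set.Ioc (0 : ℝ) 1, ∀ᶠ u in 𝓝[<] t, A u = 0 ∧ B u = 0 ∧ g u = g t - B t) :
    ∑ᶠ t ∈ Set.Ico (0 : ℝ) 1, A t - ∑ᶠ t ∈ Set.Ioc (0 : ℝ) 1, B t = g 0 - g 1 := by
  have key := eq_of_eventually_eq_sides
    (D := fun s => ∑ᶠ t ∈ Set.Ico (0 : ℝ) s, A t - ∑ᶠ t ∈ Set.Ioc (0 : ℝ) s, B t + g s) ?_ ?_
  · simp only [Set.Ico_self, Set.Ioc_self, finsum_mem_empty] at key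
    linarith
  · intro t ht
    obtain ⟨b, hb, hs⟩ := mem_nhdsGT_iff_exists_Ioo_subset.1 (hr t ht)
    filter_upwards [Ioo_mem_nhdsGT hb] with u hu
    have h1 : ∑ᶠ x ∈ Set.Ico 0 u, A x = ∑ᶠ x ∈ insert t (Set.Ico 0 t), A x := by
      refine finsum_mem_inter_support_eq' A _ _ fun x hx => ?_
      rw [Set.mem_insert_iff, Set.mem_Ico, Set.mem_Ico]
      constructor
      · rintro ⟨h1, h2⟩
        rcases lt_trichotomy x t with h | h | h
        · exact Or.inr ⟨h1, h⟩
        · exact Or.inl h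
        · exact absurd (hs ⟨h, h2.trans hu.2⟩).1 hx
      · rintro (rfl | h)
        · exact ⟨ht.1, hu.1⟩
        · exact ⟨h.1, h.2.trans hu.1⟩
    have h2 : ∑ᶠ x ∈ Set.Ioc 0 u, B x = ∑ᶠ x ∈ Set.Ioc 0 t, B x := by
      refine finsum_mem_inter_support_eq' B _ _ fun x hx => ?_
      rw [Set.mem_Ioc, Set.mem_Ioc]
      refine and_congr_right fun _ => ⟨fun h => ?_, fun h => h.trans hu.1.le⟩
      by_contra! h'
      exact hx (hs ⟨h', h.trans_lt hu.2⟩).2.1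
    rw [h1, h2, finsum_mem_insert' A (by simp), (hs hu).2.2]
    · ring
    · exact hA.subset (Set.inter_subset_inter_left _
        (Set.Ico_subset_Icc_self.trans (Set.Icc_subset_Icc_right ht.2.le)))
  · intro t ht
    obtain ⟨b, hb, hs⟩ := mem_nhdsLT_iff_exists_Ioo_subset.1 (hl t ht)
    filter_upwards [Ioo_mem_nhdsLT (max_lt hb ht.1)] with u hu
    have hu0 : 0 < u := (le_max_right _ _).trans_lt hu.1
    have hub : b < u := (le_max_left _ _).trans_lt hu.1
    have h1 : ∑ᶠ x ∈ Set.Ico 0 t, A x = ∑ᶠ x ∈ Set.Ico 0 u, A x := by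
      refine finsum_mem_inter_support_eq' A _ _ fun x hx => ?_
      rw [Set.mem_Ico, Set.mem_Ico]
      refine and_congr_right fun _ => ⟨fun h => ?_, fun h => h.trans hu.2⟩
      by_contra! h'
      exact hx (hs ⟨hub.trans_le h', h⟩).1
    have h2 : ∑ᶠ x ∈ Set.Ioc 0 t, B x = ∑ᶠ x ∈ insert t (Set.Ioc 0 u), B x := by
      refine finsum_mem_inter_support_eq' B _ _ fun x hx => ?_
      rw [Set.mem_insert_iff, Set.mem_Ioc, Set.mem_Ioc]
      constructor
      · rintro ⟨h1, h2⟩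
        rcases h2.eq_or_lt with h | h
        · exact Or.inl h
        · refine Or.inr ⟨h1, ?_⟩
          by_contra! h'
          exact hx (hs ⟨hub.trans h', h⟩).2.1
      · rintro (rfl | h)
        · exact ⟨ht.1, le_rfl⟩
        · exact ⟨h.1, h.2.trans hu.2.le⟩
    rw [h1, h2, finsum_mem_insert' B (by simpa using fun _ => hu.2),
      (hs ⟨hub, hu.2⟩ : _ ∧ _ ∧ _).2.2]
    · ring
    · exact hB.subset (Set.inter_subset_inter_left _
        (Set.Ioc_subset_Icc_self.trans (Set.Icc_subset_Icc_right (hu.2.le.trans ht.2))))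

/-! ### The sum of the crossings is the number of encirclements -/

lemma Icc_mem_nhdsGT_of_mem_Ico {t : ℝ} (ht : t ∈ Set.Ico (0 : ℝ) 1) :
    Set.Icc (0 : ℝ) 1 ∈ 𝓝[>] t := by
  filter_upwards [Ioo_mem_nhdsGT ht.2] with u hu using ⟨ht.1.trans hu.1.le, hu.2.le⟩

lemma Icc_mem_nhdsLT_of_mem_Ioc {t : ℝ} (ht : t ∈ Set.Ioc (0 : ℝ) 1) :
    Set.Icc (0 : ℝ) 1 ∈ 𝓝[<] t := by
  filter_upwards [Ioo_mem_nhdsLT ht.1] with u hu using ⟨hu.1.le, hu.2.le.trans ht.2⟩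

lemma IsAdmissible.eventually_halfCrossing_eq_zero (h : IsAdmissible L R ε) {l : Filter ℝ} {t : ℝ}
    (hl : IsSideOf l t) (hmem : Set.Icc 0 1 ∈ l) :
    ∀ᶠ u in l, ∀ l', IsSideOf l' u → halfCrossing (nicholsPlot L R ε) l' u = 0 :=
  hl.eventually_halfCrossing_eq_zero h.continuous_nyquistPlot (h.signedAlong_im hl hmem)

/-- The half crossings do not accumulate, so that they are finite in number by compactness. -/
lemma IsAdmissible.finite_halfCrossing (h : IsAdmissible L R ε) :
    {t ∈ Set.Icc (0 : ℝ) 1 |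
      ∃ l, IsSideOf l t ∧ halfCrossing (nicholsPlot L R ε) l t ≠ 0}.Finite := by
  by_contra hinf
  obtain ⟨t, ht, hacc⟩ := Set.Infinite.exists_accPt_of_subset_isCompact hinf isCompact_Icc
    fun t ht => ht.1
  rw [accPt_iff_frequently_nhdsNE] at hacc
  refine hacc ?_
  rw [← nhdsLT_sup_nhdsGT, eventually_sup]
  constructor
  · rcases ht.1.eq_or_lt with rfl | h0
    · filter_upwards [self_mem_nhdsWithin] with u hu hu'
      exact absurd hu'.1.1 (not_le.2 hu)
    · filter_upwards [h.eventually_halfCrossing_eq_zero (Or.inr rfl)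
        (Icc_mem_nhdsLT_of_mem_Ioc ⟨h0, ht.2⟩)] with u hu hu'
      obtain ⟨-, l, hl, hne⟩ := hu'
      exact hne (hu l hl)
  · rcases ht.2.eq_or_lt with rfl | h0
    · filter_upwards [self_mem_nhdsWithin] with u hu hu'
      exact absurd hu'.1.2 (not_le.2 hu)
    · filter_upwards [h.eventually_halfCrossing_eq_zero (Or.inl rfl)
        (Icc_mem_nhdsGT_of_mem_Ico ⟨ht.1, h0⟩)] with u hu hu'
      obtain ⟨-, l, hl, hne⟩ := hu'
      exact hne (hu l hl)

lemma IsAdmissible.finite_crossingSet (h : IsAdmissible L R ε) :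
    (crossingSet (nicholsPlot L R ε)).Finite := by
  refine h.finite_halfCrossing.subset fun t ht => ⟨Set.Ico_subset_Icc_self ht.1, ?_⟩
  by_contra! hcon
  refine ht.2 ?_
  rw [crossingSign_eq_sub, hcon _ (Or.inl rfl), hcon _ (Or.inr rfl), sub_zero]

lemma nicholsPlot_add_one (L : RatFunc ℝ) (R ε t : ℝ) :
    nicholsPlot L R ε (t + 1) = nicholsPlot L R ε t := by
  rw [nicholsPlot, nicholsPlot, nyquistPlot, nyquistPlot, contour_add_one]

open Function in
lemma IsAdmissible.crossingSum_eq (h : IsAdmissible L R ε) {N : ℤ}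
    (hN : Encircles (nyquistPlot L R ε) (-1) N) : crossingSum (nicholsPlot L R ε) = N := by
  obtain ⟨hne, θ, hθ, hθe, hθN⟩ := hN
  set c := nicholsPlot L R ε with hc
  have hA : (Set.Icc 0 1 ∩ support fun t => halfCrossing c (𝓝[>] t) t).Finite :=
    h.finite_halfCrossing.subset fun t ht => ⟨ht.1, _, Or.inl rfl, ht.2⟩
  have hB : (Set.Icc 0 1 ∩ support fun t => halfCrossing c (𝓝[<] t) t).Finite :=
    h.finite_halfCrossing.subset fun t ht => ⟨ht.1, _, Or.inr rfl, ht.2⟩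
  have hlocal : ∀ {t : ℝ} {l : Filter ℝ}, t ∈ Set.Icc (0 : ℝ) 1 → IsSideOf l t →
      Set.Icc (0 : ℝ) 1 ∈ l → ∀ᶠ u in l, halfCrossing c (𝓝[>] u) u = 0 ∧
        halfCrossing c (𝓝[<] u) u = 0 ∧ sheet (θ u) = sheet (θ t) - halfCrossing c l t := by
    intro t l ht hl hmem
    have hθt : Tendsto θ l (𝓝 (θ t)) :=
      (hθ t ht).mono_left (le_inf hl.le_nhds (le_principal_iff.2 hmem))
    have hform : ∀ u ∈ Set.Icc (0 : ℝ) 1, nyquistPlot L R ε u + 1 =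
        (‖nyquistPlot L R ε u + 1‖ : ℂ) * Complex.exp ((θ u : ℂ) * Complex.I) := fun u hu => by
      simpa using hθe u hu
    filter_upwards [h.eventually_halfCrossing_eq_zero hl hmem,
      hl.eventually_sheet_eq hθt (hne t ht) (hform t ht)
        (mem_of_superset hmem fun u hu => ⟨hne u hu, hform u hu⟩)
        (h.signedAlong_im hl hmem)] with u h1 h2
    exact ⟨h1 _ (Or.inl rfl), h1 _ (Or.inr rfl), h2⟩
  have hsum := finsum_jumps (g := fun t => sheet (θ t)) hA hB
    (fun t ht => hlocal (Set.Ico_subset_Icc_self ht) (Or.inl rfl) (Icc_mem_nhdsGT_of_mem_Ico ht))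
    (fun t ht => hlocal (Set.Ioc_subset_Icc_self ht) (Or.inr rfl) (Icc_mem_nhdsLT_of_mem_Ioc ht))
  have hper := halfCrossing_left_periodic (c := c) (nicholsPlot_add_one L R ε)
  have hshift : ∑ᶠ t ∈ Set.Ico (0 : ℝ) 1, halfCrossing c (𝓝[<] t) t =
      ∑ᶠ t ∈ Set.Ioc (0 : ℝ) 1, halfCrossing c (𝓝[<] t) t := by
    have hfin := hB.subset (Set.inter_subset_inter_left _
      (Set.Ioo_subset_Icc_self : Set.Ioo (0 : ℝ) 1 ⊆ _))
    rw [← Set.Ioo_insert_left zero_lt_one, ← Set.Ioo_insert_right zero_lt_one,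
      finsum_mem_insert' _ (by simp) hfin, finsum_mem_insert' _ (by simp) hfin, hper]
  have hsub : crossingSum c = ∑ᶠ t ∈ Set.Ico (0 : ℝ) 1, halfCrossing c (𝓝[>] t) t -
      ∑ᶠ t ∈ Set.Ico (0 : ℝ) 1, halfCrossing c (𝓝[<] t) t := by
    have hneg : ∑ᶠ t ∈ Set.Ico (0 : ℝ) 1, -halfCrossing c (𝓝[<] t) t =
        -∑ᶠ t ∈ Set.Ico (0 : ℝ) 1, halfCrossing c (𝓝[<] t) t :=
      (AddMonoidHom.map_finsum_mem' (-AddMonoidHom.id ℚ) (hB.subset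
        (Set.inter_subset_inter_left _ Set.Ico_subset_Icc_self))).symm
    rw [crossingSum, sub_eq_add_neg, ← hneg, ← finsum_mem_add_distrib']
    · refine finsum_mem_congr rfl fun t _ => ?_
      rw [crossingSign_eq_sub, sub_eq_add_neg]
    · exact hA.subset (Set.inter_subset_inter_left _ Set.Ico_subset_Icc_self)
    · refine hB.subset fun t ht => ⟨Set.Ico_subset_Icc_self ht.1, fun h0 => ht.2 ?_⟩
      simpa using h0
  rw [hsub, hshift, hsum]
  have : θ 0 = θ 1 + 2 * Real.pi * N := by linarith
  rw [this, sheet_add]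
  ring

/-- A closed curve that avoids a point encircles it some number of times. -/
lemma exists_encircles {γ : ℝ → ℂ} (hγ : Continuous γ) (h01 : γ 0 = γ 1) {w : ℂ}
    (hne : ∀ t, γ t ≠ w) : ∃ N : ℤ, Encircles γ w N := by
  have := (convex_univ (𝕜 := ℝ) (E := ℝ)).contractibleSpace Set.univ_nonempty
  have huniv : IsSimplyConnected (Set.univ : Set ℝ) := SimplyConnectedSpace.ofContractible _
  obtain ⟨f, hf, hexp⟩ := Complex.exists_continuousOn_eqOn_exp_comp (U := (Set.univ : Set ℝ))
    huniv isOpen_univ (g := fun t => γ t - w) (by fun_prop)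
    (by rintro ⟨t, -, ht⟩; exact hne t (sub_eq_zero.1 ht))
  have hexp : ∀ t, Complex.exp (f t) = γ t - w := fun t => hexp (Set.mem_univ t)
  have h1 : Complex.exp (f 0) = Complex.exp (f 1) := by rw [hexp, hexp, h01]
  obtain ⟨N, hN⟩ := Complex.exp_eq_exp_iff_exists_int.1 h1
  refine ⟨N, fun t _ => hne t, fun t => (f t).im,
    (Complex.continuous_im.comp_continuousOn hf).mono (Set.subset_univ _), fun t _ => ?_, ?_⟩
  · rw [← hexp, Complex.norm_exp, Complex.ofReal_exp, ← Complex.exp_add, Complex.re_add_im]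
  · have := congrArg Complex.im hN
    simp at this
    linarith

/-! ### The closed loop -/

/-- A closed-loop pole in the closed right half plane is a zero of `1 + L`, as no cancellation hides
it there. -/
lemma isClosedLoopPole_iff {P G : RatFunc ℝ} (hPG : NoUnstableCancellation P G) {s : ℂ}
    (hs : 0 ≤ s.re) :
    IsClosedLoopPole P G s ↔ Polynomial.aeval s (charNum (P * G)) = 0 := by
  have hrel := congrArg (Polynomial.aeval s) (RatFunc.num_denom_mul P G)
  have hpole := not_isPole_of_aeval_charNum_eq_zero (L := P * G) (s := s)
  have hcan := hPG s hs
  simp only [map_mul] at hrel hcan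
  simp only [IsClosedLoopPole, IsPole, charNum, map_add, map_mul] at hpole ⊢
  set a := Polynomial.aeval s P.num
  set b := Polynomial.aeval s G.num
  set d := Polynomial.aeval s P.denom
  set e := Polynomial.aeval s G.denom
  set x := Polynomial.aeval s (P * G).num
  set y := Polynomial.aeval s (P * G).denom
  constructor
  · intro h
    have hde : d * e ≠ 0 := fun h0 => hcan ⟨by linear_combination h - h0, h0⟩
    refine (mul_eq_zero.1 (?_ : (x + y) * (d * e) = 0)).resolve_right hde
    linear_combination hrel + y * h
  · intro hxy
    refine (mul_eq_zero.1 (?_ : y * (a * b + d * e) = 0)).resolve_left (hpole hxy)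
    linear_combination (d * e) * hxy - hrel

/-- Distinct points of a finite set are more than `2 * ε` apart for all small `ε`. -/
lemma exists_eps_separated (S : Finset ℂ) : ∃ ε₀ > (0 : ℝ), ∀ ε, 0 < ε → ε < ε₀ →
    ∀ p ∈ S, ∀ q ∈ S, p ≠ q → 2 * ε < ‖p - q‖ := by
  have : ∀ᶠ ε : ℝ in 𝓝[>] 0, ∀ p ∈ S, ∀ q ∈ S, p ≠ q → 2 * ε < ‖p - q‖ := by
    refine (eventually_all_finset S).2 fun p _ => (eventually_all_finset S).2 fun q _ => ?_
    rw [eventually_imp_distrib_left]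
    intro hpq
    have hcont : ContinuousAt (fun ε : ℝ => 2 * ε) 0 := by fun_prop
    refine nhdsWithin_le_nhds (hcont.eventually_lt_const ?_)
    beta_reduce
    rw [mul_zero]
    exact norm_pos_iff.2 (sub_ne_zero.2 hpq)
  obtain ⟨ε₀, h0, hs⟩ := mem_nhdsGT_iff_exists_Ioo_subset.1 this
  exact ⟨ε₀, h0, fun ε h1 h2 => hs ⟨h1, h2⟩⟩

lemma IsAdmissible.exists_contour_eq (h : IsAdmissible L R ε) {z : ℂ} (hz : z.re = 0)
    (hzR : ‖z‖ < R) (hfar : ∀ p ∈ imagAxisPoles L, ε ≤ ‖z - p‖) : ∃ t, contour L R ε t = z := by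
  have hR := h.radius_pos
  have him := (Complex.abs_im_le_norm z).trans_lt hzR
  rw [abs_lt] at him
  have hy : R * (4 * ((z.im / R + 1) / 4) - 1) = z.im := by
    field_simp
    ring
  have hd : -1 < z.im / R ∧ z.im / R < 1 := by
    rw [lt_div_iff₀ hR, div_lt_one hR]
    exact ⟨by linarith, him.2⟩
  refine ⟨(z.im / R + 1) / 4, ?_⟩
  rw [h.contour_eq ⟨by linarith, by linarith⟩, contourBase_of_le (by linarith), hy,
    indentation_eq_zero h.eps_pos.le]
  · exact Complex.ext hz.symm rfl
  · intro p hp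
    refine (hfar p hp).trans (le_of_eq ?_)
    rw [← sq_eq_sq₀ (norm_nonneg _) (abs_nonneg _),
      norm_sub_sq_of_re_eq_zero (mem_imagAxisPoles.1 hp).2, hz, sq_abs]
    ring

/-- The Nyquist criterion in the Nichols chart, for a contour that encloses the zeros of `1 + L` in
the open right half plane and keeps away from them. -/
lemma IsAdmissible.closedLoopStable_iff {P G : RatFunc ℝ} (hPG : NoUnstableCancellation P G)
    (h : IsAdmissible (P * G) R ε)
    (hin : ∀ r ∈ (charNum (P * G)).aroots ℂ,
      ‖r‖ < R ∧ ∀ q ∈ imagAxisPoles (P * G), ε < ‖r - q‖) :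
    ClosedLoopStable P G ↔
      (∀ t : ℝ, nicholsPlot (P * G) R ε t ≠ criticalPoint) ∧
        crossingSum (nicholsPlot (P * G) R ε) = -(unstablePoleCount (P * G) : ℚ) := by
  have hcrit : (∀ t : ℝ, nicholsPlot (P * G) R ε t ≠ criticalPoint) ↔
      ∀ t, nyquistPlot (P * G) R ε t ≠ -1 :=
    forall_congr' fun t => not_congr nicholsMap_eq_criticalPoint_iff
  have hsum : charNum (P * G) ≠ 0 → (∀ t, nyquistPlot (P * G) R ε t ≠ -1) →
      (crossingSum (nicholsPlot (P * G) R ε) = -(unstablePoleCount (P * G) : ℚ) ↔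
        ∀ r ∈ (charNum (P * G)).aroots ℂ, ¬ 0 < r.re) := by
    intro hp hne
    rw [h.crossingSum_eq (h.encircles_neg_one hp (fun r hr _ => hin r hr) hne),
      ← Multiset.countP_eq_zero]
    push_cast
    constructor
    · intro h0
      have : (((charNum (P * G)).aroots ℂ).countP (fun r => 0 < r.re) : ℚ) = 0 := by linarith
      exact_mod_cast this
    · intro h0
      rw [h0]
      simp
  rw [hcrit]
  constructor
  · intro hst
    have hzero : ∀ s : ℂ, 0 ≤ s.re → tfEval (P * G) s ≠ -1 := fun s hs h0 =>
      (hst s ((isClosedLoopPole_iff hPG hs).2 (tfEval_eq_neg_one_iff.1 h0))).not_ge hs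
    have hne : ∀ t, nyquistPlot (P * G) R ε t ≠ -1 := fun t => hzero _ (h.re_contour_nonneg t)
    have hp : charNum (P * G) ≠ 0 := fun h0 => hne 0
      (tfEval_eq_neg_one_iff.2 (by rw [h0, map_zero]))
    refine ⟨hne, (hsum hp hne).2 fun r hr hre => ?_⟩
    exact hzero r hre.le (tfEval_eq_neg_one_iff.2 (Polynomial.mem_aroots.1 hr).2)
  · rintro ⟨hne, hcs⟩ s hs
    have hp : charNum (P * G) ≠ 0 := fun h0 => hne 0
      (tfEval_eq_neg_one_iff.2 (by rw [h0, map_zero]))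
    by_contra! hre
    have hs := (isClosedLoopPole_iff hPG hre).1 hs
    have hr : s ∈ (charNum (P * G)).aroots ℂ := Polynomial.mem_aroots.2 ⟨hp, hs⟩
    rcases hre.eq_or_lt with h0 | h0
    · obtain ⟨t, ht⟩ := h.exists_contour_eq h0.symm (hin s hr).1 fun q hq => ((hin s hr).2 q hq).le
      exact hne t (by rw [nyquistPlot, ht]; exact tfEval_eq_neg_one_iff.2 hs)
    · exact (hsum hp hne).1 hcs s hr h0

end Nichols

theorem theorem3 (P G : RatFunc ℝ) (hPG : Nichols.NoUnstableCancellation P G)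
    (n : ℕ) (hn : Nichols.unstablePoleCount (P * G) = n) :
    (∀ R ε : ℝ, Nichols.IsAdmissible (P * G) R ε →
      (Nichols.crossingSet (Nichols.nicholsPlot (P * G) R ε)).Finite ∧
      ((∀ t : ℝ, Nichols.nyquistPlot (P * G) R ε t ≠ -1) →
        ∃ N : ℤ, Nichols.Encircles (Nichols.nyquistPlot (P * G) R ε) (-1) N ∧
          Nichols.crossingSum (Nichols.nicholsPlot (P * G) R ε) = (N : ℚ))) ∧
    (∃ R₀ > (0 : ℝ), ∃ ε₀ > (0 : ℝ), ∀ R > R₀, ∀ ε : ℝ, 0 < ε → ε < ε₀ →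
      Nichols.IsAdmissible (P * G) R ε ∧
      (Nichols.ClosedLoopStable P G ↔
        (∀ t : ℝ, Nichols.nicholsPlot (P * G) R ε t ≠ Nichols.criticalPoint) ∧
          Nichols.crossingSum (Nichols.nicholsPlot (P * G) R ε) = -(n : ℚ))) := by
  subst hn
  refine ⟨fun R ε h => ⟨h.finite_crossingSet, fun hne => ?_⟩, ?_⟩
  · obtain ⟨N, hN⟩ := Nichols.exists_encircles h.continuous_nyquistPlot
      (by rw [Nichols.nyquistPlot, ← Nichols.contour_add_one, zero_add]; rfl) hne
    exact ⟨N, hN, h.crossingSum_eq hN⟩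
  · classical
    set S : Finset ℂ := ((P * G).denom.aroots ℂ).toFinset ∪
      ((Nichols.charNum (P * G)).aroots ℂ).toFinset with hS
    have hpole : ∀ p, Nichols.IsPole (P * G) p → p ∈ S := fun p hp =>
      Finset.mem_union_left _ (Multiset.mem_toFinset.2
        (Polynomial.mem_aroots.2 ⟨(P * G).denom_ne_zero, hp⟩))
    have hchar : ∀ r ∈ (Nichols.charNum (P * G)).aroots ℂ, r ∈ S := fun r hr =>
      Finset.mem_union_right _ (Multiset.mem_toFinset.2 hr)
    have hnorm : ∀ p ∈ S, ‖p‖ ≤ ∑ q ∈ S, ‖q‖ := fun p hp =>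
      Finset.single_le_sum (f := fun q : ℂ => ‖q‖) (fun _ _ => norm_nonneg _) hp
    have hsum : 0 ≤ ∑ q ∈ S, ‖q‖ := Finset.sum_nonneg fun _ _ => norm_nonneg _
    obtain ⟨ε₁, hε₁, hsep⟩ := Nichols.exists_eps_separated S
    refine ⟨∑ q ∈ S, ‖q‖ + 1, by linarith, min ε₁ 1, lt_min hε₁ one_pos,
      fun R hR ε hε hε' => ?_⟩
    have hsep := hsep ε hε (hε'.trans_le (min_le_left _ _))
    have hε1 := hε'.trans_le (min_le_right _ _)
    have hadm : Nichols.IsAdmissible (P * G) R ε :=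
      { radius_pos := by linarith
        eps_pos := hε
        encloses := fun p hp _ => by linarith [hnorm p (hpole p hp)]
        separated := fun p q hp hq _ _ hpq => hsep p (hpole p hp) q (hpole q hq) hpq }
    refine ⟨hadm, hadm.closedLoopStable_iff hPG fun r hr => ⟨?_, fun q hq => ?_⟩⟩
    · linarith [hnorm r (hchar r hr)]
    · have hq := (Nichols.mem_imagAxisPoles.1 hq).1
      have hrq : r ≠ q := by
        rintro rfl
        exact Nichols.not_isPole_of_aeval_charNum_eq_zero (Polynomial.mem_aroots.1 hr).2 hq
      linarith [hsep r (hchar r hr) q (hpole q hq) hrq]
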